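/- Let $(\mathcal P,d,\mu)$ be a metric space with a Borel regular outer measure $\mu$ for which every ball $B(x,r)=\{y:d(x,y)<r\}$ ($r>0$) has positive and finite measure. Suppose that there are constants $c>0$ and $Q>0$ with $$\frac{\mu(B(y,r))}{\mu(B(x,R))}\ge c\Big(\frac rR\Big)^Q\qquad\text{for all }x\in\mathcal P,\ 0<r\le R,\ y\in B(x,R).\tag{Q}$$ (In particular $\mu$ is doubling.) Let $L^0$ be the set of $\mu$-measurable, almost everywhere finite functions $\mathcal P\to[-\infty,\infty]$. Let $X$ be a quasi-Banach function space over $\mathcal P$: a linear subspace of $L^0$ with a complete quasinorm $\|\cdot\|_X$ (that is, $\|f\|_X=0$ iff $f=0$ a.e., $\|\alpha f\|_X=|\alpha|\|f\|_X$ for $\alpha\in\mathbb R$, and $\|f+g\|_X\le c_\Delta(\|f\|_X+\|g\|_X)$ for a constant $c_\Delta$) such that, with $\|f\|_X=\infty$ for $f\notin X$, (i) if $g\in X$, $f\in L^0$ and $|f|\le|g|$ a.e., then $f\in X$ and $\|f\|_X\le\|g\|_X$; (ii) $\|\chi_E\|_X<\infty$ for every measurable $E$ with $\mu(E)<\infty$;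 (iii) if $f_k,f\in L^0$ and $0\le f_k\uparrow f$ a.e., then $\|f_k\|_X\uparrow\|f\|_X$. Suppose that the quasinorm is absolutely continuous: $\|f\chi_{E_k}\|_X\to0$ whenever $f\in X$ and $(E_k)_{k\ge1}$ is a decreasing sequence of measurable sets with $\bigcap_kE_k=\emptyset$. Let $0<s\le1$. A measurable $g:\mathcal P\to[0,\infty]$ is an $s$-gradient of $u\in L^0$ if there is a set $N$ with $\mu(N)=0$, outside which $u$ is finite, such that $|u(x)-u(y)|\le d(x,y)^s(g(x)+g(y))$ for all $x,y\in\mathcal P\setminus N$. Put $\|u\|_{\dot M^{s,X}}=\inf\|g\|_X$, the infimum being over all $s$-gradients $g$ of $u$; let $\dot M^{s,X}=\{u\in L^0:\|u\|_{\dot M^{s,X}}<\infty\}$, $M^{s,X}=\dot M^{s,X}\cap X$ and $\|u\|_{M^{s,X}}=\|u\|_X+\|u\|_{\dot M^{s,X}}$. The capacity of $E\subset\mathcal P$ is $$C_{M^{s,X}}(E)=\inf\{\|u\|_{M^{s,X}}:u\in M^{s,X},\ u\ge1\text{ on a neighbourhood of }E\}\qquad(\inf\emptyset=\infty).$$ A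 property holds at quasievery point if it holds outside a set of capacity zero. A function $u:\mathcal P\to[-\infty,\infty]$ is quasicontinuous if for every $\varepsilon>0$ there is $E\subset\mathcal P$ with $C_{M^{s,X}}(E)<\varepsilon$ such that the restriction of $u$ to $\mathcal P\setminus E$ is continuous. Let $q=Q/(Q+s)$ and, for measurable $h\ge0$, let $\mathcal M_1h(x)=\sup_{0<r<1}\mu(B(x,r))^{-1}\int_{B(x,r)}h\,d\mu$. Suppose that for every ball $B\subset\mathcal P$ there is a constant $C$ such that $$\|(\mathcal M_1g^q)^{1/q}\chi_B\|_X\le C\|g\|_X\qquad\text{for every }0\le g\in X.$$ Then for every quasicontinuous $u\in\dot M^{s,X}$, quasievery point $x\in\mathcal P$ is a Lebesgue point of $u$, that is, $u(x)$ is finite, $u$ is integrable over $B(x,r)$ for all sufficiently small $r>0$, and $$\lim_{r\to0}\frac1{\mu(B(x,r))}\int_{B(x,r)}u\,d\mu=u(x).$$ -/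

import Mathlib

open MeasureTheory Metric Set Filter Topology
open scoped ENNReal NNReal

namespace HajlaszLebesgue

variable {P : Type*} [MetricSpace P] [MeasurableSpace P]

/-- Every ball has positive and finite measure. -/
def BallsPosFinite (μ : Measure P) : Prop :=
  ∀ (x : P) (r : ℝ), 0 < r → 0 < μ (ball x r) ∧ μ (ball x r) < ∞

/-- The lower mass bound with exponent `Q`:
`μ(B(y,r)) / μ(B(x,R)) ≥ c (r/R)^Q` for all `x`, `0 < r ≤ R` and `y ∈ B(x,R)`. -/
def LowerMassBound (μ : Measure P) (Q : ℝ) : Prop :=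
  ∃ c : ℝ, 0 < c ∧ ∀ (x y : P) (r R : ℝ), 0 < r → r ≤ R → y ∈ ball x R →
    ENNReal.ofReal (c * (r / R) ^ Q) ≤ μ (ball y r) / μ (ball x R)

/-- `L⁰`: the extended real valued `μ`-measurable functions that are finite almost everywhere. -/
def MemL0 (μ : Measure P) (f : P → EReal) : Prop :=
  AEMeasurable f μ ∧ ∀ᵐ x ∂μ, f x ≠ ⊤ ∧ f x ≠ ⊥

/-- A quasi-Banach function space `X` over `(P, d, μ)`. The quasinorm is extended by the value `∞`
to all functions outside `X`, so that `f ∈ X` means `qnorm f < ∞`. -/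
structure QuasiBanachFunctionSpace (μ : Measure P) where
  /-- The quasinorm of `X`, with value `∞` exactly outside `X`. -/
  qnorm : (P → EReal) → ℝ≥0∞
  /-- `X ⊆ L⁰`. -/
  memL0 : ∀ f, qnorm f < ∞ → MemL0 μ f
  /-- The quasinorm vanishes exactly on the functions that are zero almost everywhere. -/
  qnorm_eq_zero_iff : ∀ f, qnorm f = 0 ↔ f =ᵐ[μ] 0
  /-- Homogeneity. -/
  qnorm_smul : ∀ (a : ℝ) (f : P → EReal), qnorm f < ∞ →
    qnorm (fun x => (a : EReal) * f x) = ENNReal.ofReal |a| * qnorm f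
  /-- The quasi-triangle inequality. -/
  qnorm_add_le : ∃ c : ℝ≥0, ∀ f g : P → EReal, qnorm f < ∞ → qnorm g < ∞ →
    qnorm (fun x => f x + g x) ≤ c * (qnorm f + qnorm g)
  /-- Completeness: every Cauchy sequence of elements of `X` converges in `X`. -/
  complete : ∀ f : ℕ → P → EReal, (∀ n, qnorm (f n) < ∞) →
    (∀ ε : ℝ≥0∞, 0 < ε → ∃ N, ∀ m ≥ N, ∀ n ≥ N, qnorm (fun x => f m x - f n x) < ε) →
    ∃ F : P → EReal, qnorm F < ∞ ∧
      Tendsto (fun n => qnorm (fun x => f n x - F x)) atTop (𝓝 0)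
  /-- The lattice property. -/
  qnorm_mono : ∀ f g : P → EReal, qnorm g < ∞ → MemL0 μ f →
    (∀ᵐ x ∂μ, (f x).abs ≤ (g x).abs) → qnorm f ≤ qnorm g
  /-- Characteristic functions of sets of finite measure belong to `X`. -/
  qnorm_indicator_lt_top : ∀ E : Set P, NullMeasurableSet E μ → μ E < ∞ →
    qnorm (E.indicator fun _ => (1 : EReal)) < ∞
  /-- The Fatou property: if `0 ≤ f k ↑ F` a.e., then the quasinorms of the `f k` increase to that
  of `F` (they increase by `qnorm_mono`). -/
  qnorm_fatou : ∀ (f : ℕ → P → EReal) (F : P → EReal), (∀ k, MemL0 μ (f k)) → MemL0 μ F →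
    (∀ᵐ x ∂μ, 0 ≤ f 0 x ∧ Monotone (fun k => f k x) ∧
      Tendsto (fun k => f k x) atTop (𝓝 (F x))) →
    Tendsto (fun k => qnorm (f k)) atTop (𝓝 (qnorm F))

namespace QuasiBanachFunctionSpace

variable {μ : Measure P} (X : QuasiBanachFunctionSpace μ)

/-- Membership in `X`. -/
def Mem (f : P → EReal) : Prop := X.qnorm f < ∞

/-- The (extended) quasinorm of a `[0, ∞]`-valued function. -/
noncomputable def qnormNonneg (g : P → ℝ≥0∞) : ℝ≥0∞ := X.qnorm fun x => (g x : EReal)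

/-- The quasinorm of `X` is absolutely continuous: `‖f χ_{E k}‖ → 0` whenever `f ∈ X` and `E k` is
a decreasing sequence of measurable sets with empty intersection. -/
def AbsolutelyContinuous : Prop :=
  ∀ (f : P → EReal) (E : ℕ → Set P), X.Mem f → (∀ k, NullMeasurableSet (E k) μ) →
    Antitone E → ⋂ k, E k = ∅ → Tendsto (fun k => X.qnorm ((E k).indicator f)) atTop (𝓝 0)

end QuasiBanachFunctionSpace

/-- `g` is an `s`-gradient of `u ∈ L⁰`: `|u(x) - u(y)| ≤ d(x,y)^s (g(x) + g(y))` for all `x, y`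
outside a null set `E` (containing the points where `u` is infinite). -/
def IsSGradient (μ : Measure P) (s : ℝ) (u : P → EReal) (g : P → ℝ≥0∞) : Prop :=
  AEMeasurable g μ ∧ ∃ E : Set P, μ E = 0 ∧ (∀ x ∉ E, u x ≠ ⊤ ∧ u x ≠ ⊥) ∧
    ∀ x ∉ E, ∀ y ∉ E,
      ENNReal.ofReal |(u x).toReal - (u y).toReal| ≤ edist x y ^ s * (g x + g y)

section Hajlasz

variable {μ : Measure P} (X : QuasiBanachFunctionSpace μ) (s : ℝ)

/-- The homogeneous Hajlasz seminorm: the infimum of `‖g‖_X` over all `s`-gradients `g` of `u`. -/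
noncomputable def homHajlaszNorm (u : P → EReal) : ℝ≥0∞ :=
  ⨅ (g : P → ℝ≥0∞) (_ : IsSGradient μ s u g), X.qnormNonneg g

/-- Membership in the homogeneous Hajlasz space `Ṁ^{s,X}`. -/
def MemHomHajlasz (u : P → EReal) : Prop := MemL0 μ u ∧ homHajlaszNorm X s u < ∞

/-- Membership in the Hajlasz space `M^{s,X} = Ṁ^{s,X} ∩ X`. -/
def MemHajlasz (u : P → EReal) : Prop := MemHomHajlasz X s u ∧ X.Mem u

/-- The norm of `M^{s,X}`. -/
noncomputable def hajlaszNorm (u : P → EReal) : ℝ≥0∞ := X.qnorm u + homHajlaszNorm X s u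

/-- Functions admissible for the capacity of `E`: those `u ∈ M^{s,X}` with `u ≥ 1` on a
neighbourhood of `E`. -/
def Admissible (E : Set P) (u : P → EReal) : Prop :=
  MemHajlasz X s u ∧ ∃ U : Set P, IsOpen U ∧ E ⊆ U ∧ ∀ x ∈ U, 1 ≤ u x

/-- The `M^{s,X}`-capacity (infimum `∞` if there is no admissible function). -/
noncomputable def capacity (E : Set P) : ℝ≥0∞ :=
  ⨅ (u : P → EReal) (_ : Admissible X s E u), hajlaszNorm X s u

/-- A property holds quasieverywhere if it holds outside a set of capacity zero. -/
def Quasieverywhere (p : P → Prop) : Prop :=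
  ∃ E : Set P, capacity X s E = 0 ∧ ∀ x ∉ E, p x

/-- `u : P → [-∞, ∞]` is quasicontinuous if its restriction to the complement of some set of
arbitrarily small capacity is continuous. -/
def Quasicontinuous (u : P → EReal) : Prop :=
  ∀ ε : ℝ≥0∞, 0 < ε → ∃ E : Set P, capacity X s E < ε ∧ ContinuousOn u Eᶜ

end Hajlasz

/-- The restricted Hardy-Littlewood maximal function of a nonnegative function,
`M_R g (x) = sup_{0 < r < R} μ(B(x,r))⁻¹ ∫_{B(x,r)} g dμ`. -/
noncomputable def restrictedMaximal (μ : Measure P) (R : ℝ) (g : P → ℝ≥0∞) (x : P) : ℝ≥0∞ :=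
  ⨆ (r : ℝ) (_ : 0 < r) (_ : r < R), ⨍⁻ y in ball x r, g y ∂μ

/-- For every ball `B` there is a constant `C` with `‖(M_1 g^q)^{1/q} χ_B‖_X ≤ C ‖g‖_X` for all
`0 ≤ g ∈ X`. -/
def MaximalLocallyBounded {μ : Measure P} (X : QuasiBanachFunctionSpace μ) (q : ℝ) : Prop :=
  ∀ (x₀ : P) (ρ : ℝ), 0 < ρ → ∃ C : ℝ≥0, ∀ g : P → ℝ≥0∞, X.qnormNonneg g < ∞ →
    X.qnormNonneg ((ball x₀ ρ).indicator fun x =>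
      (restrictedMaximal μ 1 (fun y => g y ^ q) x) ^ (1 / q)) ≤ C * X.qnormNonneg g

/-- `x` is a Lebesgue point of the (almost everywhere finite) function `u`: the value `u x` is
finite, `u` is integrable on small balls centred at `x`, and the integral averages of `u` over
`B(x,r)` converge to `u x` as `r → 0`. -/
def IsLebesguePoint (μ : Measure P) (u : P → EReal) (x : P) : Prop :=
  (u x ≠ ⊤ ∧ u x ≠ ⊥) ∧
  (∃ r₀ : ℝ, 0 < r₀ ∧ IntegrableOn (fun y => (u y).toReal) (ball x r₀) μ) ∧
  Tendsto (fun r : ℝ => ⨍ y in ball x r, (u y).toReal ∂μ) (𝓝[>] 0) (𝓝 (u x).toReal)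

end HajlaszLebesgue

/-!
# Lebesgue points of quasicontinuous Hajłasz functions

Let `g ∈ X` be an `s`-gradient of `u`. Extending `u` from `{g ≤ l}` by McShane's formula gives a
Hölder function `v`, and `w = |u - v|` has the `s`-gradient `h = 4 g χ_{g > l}`
(`exists_truncation`). On a ball that meets `{g ≤ l}` the function `w` is also bounded by a multiple
of `h`, because it vanishes on `{g ≤ l}`. By absolute continuity of the quasinorm `‖h‖_X → 0` as
`l → ∞`. Every point is a Lebesgue point of the continuous function `v`, so it remains to see that
the points of a ball where `w`, or an average of `w` over some small ball, exceeds a given level form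
a set of small capacity.

For the values of `w` this follows from quasicontinuity: up to a set of small capacity the
superlevel set is open, and a multiple of `w`, cut off, is admissible
(`exists_capacity_superlevel_le`). No comparison of two quasicontinuous functions that agree almost
everywhere is needed.

For the averages (`exists_capacity_maximal_le`) the admissible function is the cut-off supremum of
smooth averages `S_ρ w`, `ρ < 1/8`. Its gradient is a multiple of `k = h + (M₁ h^q)^{1/q}`, which
belongs to `X` locally by assumption (`exists_smoothMaximal_gradient`). At points at distance at
most `ρ`, the averages `S_ρ w` differ by the Lipschitz dependence of the kernel on its centre times
the mean oscillation of `w` at scale `ρ`; at larger distances, they are compared with the values of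
`w`.

Both comparisons rest on the Sobolev–Poincaré inequality at the critical exponent `q = Q / (Q + s)`,
in the pointwise form
`|w x - a| ≤ C R^s T (1 + (h x / T)^q)` on `B(x₀,R)`, where `T^q` bounds the mean of `h^q` over
`B(x₀,2R)` (`exists_pointwise_poincare`). It is proved by chaining through the level sets of `h`. By
the lower mass bound and Chebyshev's inequality a point with `h ≤ 2^{n+1} T` lies within distance
`R 2^{-n/(Q+s)}`, up to constants, of a point with `h ≤ 2^n T`; this step changes `w` by a multiple
of `R^s T 2^{nq}`, and the sum of these costs is comparable to the last one. As the values
at the two points are compared directly, no Lebesgue differentiation theorem is used.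

Capacities are handled through `[0, ∞]`-valued functions (`IsNonnegSGradientOn`, `capacity_le`,
`exists_of_capacity_lt`), for which completeness of `X` gives countable quasi-subadditivity
(`exists_qnormNonneg_tsum_le`, `exists_capacity_iUnion_le`).
-/

namespace HajlaszLebesgue

/-! ### The quasinorm on nonnegative functions -/

section Quasinorm

variable {P : Type*} [MeasurableSpace P] {μ : Measure P}

theorem measurable_ereal_abs : Measurable EReal.abs :=
  EReal.measurable_of_measurable_real <| by
    simp only [EReal.abs_def]
    exact ENNReal.measurable_ofReal.comp continuous_abs.measurable

theorem coe_ennreal_abs (a : ℝ≥0∞) : (a : EReal).abs = a := by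
  induction a with
  | top => simp
  | coe a =>
    have : ((a : ℝ≥0∞) : EReal) = ((a : ℝ) : EReal) := rfl
    rw [this, EReal.abs_def, abs_of_nonneg a.coe_nonneg]; simp

theorem memL0_coe_ennreal {f : P → ℝ≥0∞} (hf : AEMeasurable f μ) (hfin : ∀ᵐ x ∂μ, f x ≠ ⊤) :
    MemL0 μ (fun x => (f x : EReal)) :=
  ⟨hf.coe_ereal_ennreal, by filter_upwards [hfin] with x hx; simp [hx]⟩

theorem memL0_coe_real {f : P → ℝ} (hf : AEMeasurable f μ) : MemL0 μ (fun x => (f x : EReal)) :=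
  ⟨hf.coe_real_ereal, by simp⟩

namespace QuasiBanachFunctionSpace

variable (X : QuasiBanachFunctionSpace μ)

theorem aemeasurable_of_qnormNonneg_lt_top {f : P → ℝ≥0∞} (hf : X.qnormNonneg f < ∞) :
    AEMeasurable f μ := by
  have := (X.memL0 _ hf).1.ereal_toENNReal
  simpa using this

theorem ae_ne_top_of_qnormNonneg_lt_top {f : P → ℝ≥0∞} (hf : X.qnormNonneg f < ∞) :
    ∀ᵐ x ∂μ, f x ≠ ⊤ := by
  filter_upwards [(X.memL0 _ hf).2] with x hx h
  exact hx.1 (by simp [h])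

theorem qnormNonneg_mono_ae {f g : P → ℝ≥0∞} (hf : AEMeasurable f μ) (h : ∀ᵐ x ∂μ, f x ≤ g x) :
    X.qnormNonneg f ≤ X.qnormNonneg g := by
  rcases eq_or_ne (X.qnormNonneg g) ⊤ with hg | hg
  · rw [hg]; exact le_top
  refine X.qnorm_mono _ _ hg.lt_top (memL0_coe_ennreal hf ?_) ?_
  · filter_upwards [h, X.ae_ne_top_of_qnormNonneg_lt_top hg.lt_top] with x h1 h2 h3
    exact h2 (top_le_iff.1 (h3 ▸ h1))
  · simpa only [coe_ennreal_abs] using h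

theorem qnormNonneg_zero : X.qnormNonneg (fun _ => 0) = 0 :=
  (X.qnorm_eq_zero_iff _).2 (Eventually.of_forall fun x => by simp)

theorem qnormNonneg_abs {f : P → EReal} (hf : X.qnorm f < ∞) :
    X.qnormNonneg (fun x => (f x).abs) ≤ X.qnorm f := by
  have h0 := X.memL0 f hf
  refine X.qnorm_mono _ _ hf (memL0_coe_ennreal (measurable_ereal_abs.comp_aemeasurable h0.1) ?_) ?_
  · filter_upwards [h0.2] with x hx h
    rw [← EReal.coe_toReal hx.1 hx.2, EReal.abs_def] at h
    exact ENNReal.ofReal_ne_top h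
  · simp only [coe_ennreal_abs]
    exact Eventually.of_forall fun x => le_rfl

theorem qnormNonneg_const_mul (c : ℝ≥0) (f : P → ℝ≥0∞) :
    X.qnormNonneg (fun x => c * f x) ≤ c * X.qnormNonneg f := by
  rcases eq_or_ne c 0 with rfl | hc
  · simp [X.qnormNonneg_zero]
  rcases eq_or_ne (X.qnormNonneg f) ⊤ with hf | hf
  · rw [hf, ENNReal.mul_top (by simpa using hc)]; exact le_top
  have := X.qnorm_smul c _ hf.lt_top
  rw [abs_of_nonneg c.coe_nonneg, ENNReal.ofReal_coe_nnreal] at this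
  refine le_of_eq ?_
  rw [← qnormNonneg] at this
  rw [← this, qnormNonneg]
  congr 1; funext x
  rw [EReal.coe_ennreal_mul]; rfl

theorem exists_qnormNonneg_add_le : ∃ K : ℝ≥0, 1 ≤ K ∧ ∀ f g : P → ℝ≥0∞,
    X.qnormNonneg (fun x => f x + g x) ≤ K * (X.qnormNonneg f + X.qnormNonneg g) := by
  obtain ⟨c, hc⟩ := X.qnorm_add_le
  refine ⟨max c 1, le_max_right _ _, fun f g => ?_⟩
  have hK : ((max c 1 : ℝ≥0) : ℝ≥0∞) ≠ 0 := by
    have : (0 : ℝ≥0) < max c 1 := lt_of_lt_of_le one_pos (le_max_right _ _)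
    exact_mod_cast this.ne'
  by_cases h : X.qnormNonneg f + X.qnormNonneg g = ⊤
  · rw [h, ENNReal.mul_top hK]; exact le_top
  have h' := ENNReal.add_ne_top.1 h
  have := hc _ _ h'.1.lt_top h'.2.lt_top
  calc X.qnormNonneg (fun x => f x + g x) ≤ c * (X.qnormNonneg f + X.qnormNonneg g) := by
        simpa only [qnormNonneg, EReal.coe_ennreal_add] using this
    _ ≤ _ := by gcongr; exact le_max_left _ _

/-- Finite sums: the `i`-th term is charged `i + 1` applications of the quasi-triangle
inequality. -/
theorem qnormNonneg_sum_range_le {K : ℝ≥0}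
    (hK : ∀ f g : P → ℝ≥0∞,
      X.qnormNonneg (fun x => f x + g x) ≤ K * (X.qnormNonneg f + X.qnormNonneg g))
    (n : ℕ) : ∀ f : ℕ → P → ℝ≥0∞, X.qnormNonneg (fun x => ∑ i ∈ Finset.range n, f i x) ≤
      ∑ i ∈ Finset.range n, (K : ℝ≥0∞) ^ (i + 1) * X.qnormNonneg (f i) := by
  induction n with
  | zero => intro f; simp [X.qnormNonneg_zero]
  | succ n ih =>
    intro f
    simp only [Finset.sum_range_succ']
    calc X.qnormNonneg (fun x => (∑ i ∈ Finset.range n, f (i + 1) x) + f 0 x)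
        ≤ K * (X.qnormNonneg (fun x => ∑ i ∈ Finset.range n, f (i + 1) x)
          + X.qnormNonneg (f 0)) := hK _ _
      _ ≤ K * ((∑ i ∈ Finset.range n, (K : ℝ≥0∞) ^ (i + 1) * X.qnormNonneg (f (i + 1)))
          + X.qnormNonneg (f 0)) := by
        gcongr; exact ih _
      _ = _ := by
        rw [mul_add, Finset.mul_sum]
        congr 1
        · refine Finset.sum_congr rfl fun i _ => ?_
          rw [pow_succ' _ (i + 1), mul_assoc]
        · simp

/-- Countable quasi-subadditivity. Completeness of `X` yields a limit of the partial sums, which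
dominates the series. -/
theorem exists_qnormNonneg_tsum_le : ∃ K : ℝ≥0, 1 ≤ K ∧ ∀ f : ℕ → P → ℝ≥0∞,
    (∀ n, AEMeasurable (f n) μ) →
    X.qnormNonneg (fun x => ∑' n, f n x) ≤ ∑' n, (K : ℝ≥0∞) ^ (n + 1) * X.qnormNonneg (f n) := by
  obtain ⟨K, hK1, hK⟩ := X.exists_qnormNonneg_add_le
  have hK1' : (1 : ℝ≥0∞) ≤ K := by exact_mod_cast hK1
  refine ⟨K ^ 2, one_le_pow₀ hK1, fun f hfm => ?_⟩
  set σ : ℝ≥0∞ := ∑' n, (K : ℝ≥0∞) ^ (n + 1) * X.qnormNonneg (f n) with hσ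
  have hσle : K * σ ≤ ∑' n, ((K ^ 2 : ℝ≥0) : ℝ≥0∞) ^ (n + 1) * X.qnormNonneg (f n) := by
    rw [hσ, ← ENNReal.tsum_mul_left]
    refine ENNReal.tsum_le_tsum fun n => ?_
    rw [← mul_assoc]
    gcongr
    rw [ENNReal.coe_pow, ← pow_mul, ← pow_succ']
    exact pow_le_pow_right₀ hK1' (by omega)
  refine le_trans ?_ hσle
  rcases eq_or_ne σ ⊤ with hσt | hσt
  · rw [hσt, ENNReal.mul_top (by positivity)]; exact le_top
  have hterm : ∀ n, X.qnormNonneg (f n) < ∞ := by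
    intro n
    have h1 := ENNReal.ne_top_of_tsum_ne_top hσt n
    refine lt_of_le_of_lt ?_ h1.lt_top
    calc X.qnormNonneg (f n) = 1 * X.qnormNonneg (f n) := (one_mul _).symm
      _ ≤ K ^ (n + 1) * X.qnormNonneg (f n) := by gcongr; exact one_le_pow₀ hK1'
  -- the series is compared with real-valued representatives, for which differences make sense
  set a : ℕ → P → ℝ := fun n x => (f n x).toReal with ha
  have ham : ∀ n, AEMeasurable (a n) μ := fun n => (hfm n).ennreal_toReal
  have hfa : ∀ᵐ x ∂μ, ∀ n, f n x = ENNReal.ofReal (a n x) := by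
    rw [ae_all_iff]; intro n
    filter_upwards [X.ae_ne_top_of_qnormNonneg_lt_top (hterm n)] with x hx
    exact (ENNReal.ofReal_toReal hx).symm
  set S : ℕ → P → ℝ := fun n x => ∑ i ∈ Finset.range n, a i x with hS
  have hSm : ∀ n, AEMeasurable (S n) μ := fun n => by
    have := Finset.aemeasurable_sum (μ := μ) (Finset.range n) (fun i _ => ham i)
    convert this using 1
    funext x; simp [hS]
  have hSf : ∀ᵐ x ∂μ, ∀ n, ENNReal.ofReal (S n x) = ∑ i ∈ Finset.range n, f i x := by
    filter_upwards [hfa] with x hx n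
    rw [ENNReal.ofReal_sum_of_nonneg (fun i _ => ENNReal.toReal_nonneg)]
    exact Finset.sum_congr rfl fun i _ => (hx i).symm
  have hSnn : ∀ n x, 0 ≤ S n x := fun n x => Finset.sum_nonneg fun i _ => ENNReal.toReal_nonneg
  -- the quasinorm of a difference of partial sums is bounded by a tail of `σ`
  have hdiff : ∀ n m, n ≤ m → X.qnorm (fun x => ((S m x - S n x : ℝ) : EReal)) ≤
      ∑' i, (K : ℝ≥0∞) ^ (i + n + 1) * X.qnormNonneg (f (i + n)) := by
    intro n m hnm
    have h1 : X.qnormNonneg (fun x => ∑ i ∈ Finset.range (m - n), f (i + n) x) ≤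
        ∑' i, (K : ℝ≥0∞) ^ (i + n + 1) * X.qnormNonneg (f (i + n)) := by
      refine (X.qnormNonneg_sum_range_le hK _ _).trans ?_
      refine le_trans ?_ (ENNReal.sum_le_tsum (Finset.range (m - n)))
      refine Finset.sum_le_sum fun i _ => ?_
      gcongr
      omega
    have h1' : X.qnormNonneg (fun x => ∑ i ∈ Finset.range (m - n), f (i + n) x) < ∞ := by
      refine lt_of_le_of_lt h1 (lt_of_le_of_lt ?_ hσt.lt_top)
      exact ENNReal.tsum_comp_le_tsum_of_injective (f := fun i => i + n) (add_left_injective n)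
        (fun i => (K : ℝ≥0∞) ^ (i + 1) * X.qnormNonneg (f i))
    refine le_trans ?_ h1
    refine X.qnorm_mono _ _ h1' (memL0_coe_real ((hSm m).sub (hSm n))) ?_
    filter_upwards [hfa] with x hx
    rw [coe_ennreal_abs, EReal.abs_def]
    have : S m x - S n x = ∑ i ∈ Finset.range (m - n), a (i + n) x := by
      obtain ⟨k, rfl⟩ := Nat.exists_eq_add_of_le hnm
      simp only [hS, Finset.sum_range_add, Nat.add_sub_cancel_left, add_sub_cancel_left]
      exact Finset.sum_congr rfl fun i _ => by rw [add_comm]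
    rw [this, abs_of_nonneg (Finset.sum_nonneg fun i _ => ENNReal.toReal_nonneg),
      ENNReal.ofReal_sum_of_nonneg (fun i _ => ENNReal.toReal_nonneg)]
    exact Finset.sum_le_sum fun i _ => (hx _).symm.le
  have htail : Tendsto (fun n => ∑' i, (K : ℝ≥0∞) ^ (i + n + 1) * X.qnormNonneg (f (i + n)))
      atTop (𝓝 0) :=
    ENNReal.tendsto_sum_nat_add (fun i => (K : ℝ≥0∞) ^ (i + 1) * X.qnormNonneg (f i)) hσt
  have hSσ : ∀ n, X.qnormNonneg (fun x => ENNReal.ofReal (S n x)) ≤ σ := by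
    intro n
    refine (X.qnormNonneg_mono_ae (hSm n).ennreal_ofReal
      (g := fun x => ∑ i ∈ Finset.range n, f i x) ?_).trans ?_
    · filter_upwards [hSf] with x hx using (hx n).le
    · exact (X.qnormNonneg_sum_range_le hK n f).trans (ENNReal.sum_le_tsum _)
  have hSreal : ∀ n, X.qnorm (fun x => ((S n x : ℝ) : EReal)) < ∞ := by
    intro n
    refine lt_of_le_of_lt ?_ (lt_of_le_of_lt (hSσ n) hσt.lt_top)
    refine X.qnorm_mono _ _ (lt_of_le_of_lt (hSσ n) hσt.lt_top) (memL0_coe_real (hSm n)) ?_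
    refine Eventually.of_forall fun x => ?_
    rw [coe_ennreal_abs, EReal.abs_def, abs_of_nonneg (hSnn n x)]
  have hsymm : ∀ n m, X.qnorm (fun x => ((S n x - S m x : ℝ) : EReal)) < ∞ →
      X.qnorm (fun x => ((S m x - S n x : ℝ) : EReal)) ≤
      X.qnorm (fun x => ((S n x - S m x : ℝ) : EReal)) := by
    intro n m h
    refine X.qnorm_mono _ _ h (memL0_coe_real ((hSm m).sub (hSm n))) ?_
    refine Eventually.of_forall fun x => ?_
    rw [EReal.abs_def, EReal.abs_def, abs_sub_comm]
  have hσtail : ∀ n, ∑' i, (K : ℝ≥0∞) ^ (i + n + 1) * X.qnormNonneg (f (i + n)) < ∞ := fun n =>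
    lt_of_le_of_lt (ENNReal.tsum_comp_le_tsum_of_injective (f := fun i => i + n)
      (add_left_injective n) (fun i => (K : ℝ≥0∞) ^ (i + 1) * X.qnormNonneg (f i))) hσt.lt_top
  obtain ⟨F, hF, hFlim⟩ := X.complete (fun n x => ((S n x : ℝ) : EReal)) hSreal (by
    intro ε hε
    obtain ⟨M, hM⟩ := (htail.eventually (gt_mem_nhds hε)).exists_forall_of_atTop
    refine ⟨M, fun m hm n hn => ?_⟩
    simp only [← EReal.coe_sub]
    rcases le_total n m with h | h
    · exact (hdiff n m h).trans_lt (hM n hn)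
    · have h2 := hdiff m n h
      exact ((hsymm n m (h2.trans_lt (hσtail m))).trans h2).trans_lt (hM m hm))
  have hF0 := X.memL0 F hF
  set b : P → ℝ := fun x => (F x).toReal with hb
  have hbm : AEMeasurable b μ := hF0.1.ereal_toReal
  have hFb : ∀ᵐ x ∂μ, F x = (b x : EReal) := by
    filter_upwards [hF0.2] with x hx using (EReal.coe_toReal hx.1 hx.2).symm
  have hlim_fin : ∀ᶠ m in atTop, X.qnorm (fun x => ((S m x : ℝ) : EReal) - F x) < 1 :=
    hFlim.eventually (gt_mem_nhds one_pos)
  -- the limit dominates the partial sums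
  have hdom : ∀ n, ∀ᵐ x ∂μ, S n x ≤ b x := by
    intro n
    have hz : X.qnorm (fun x => ((max (S n x - b x) 0 : ℝ) : EReal)) = 0 := by
      refine le_antisymm (ge_of_tendsto hFlim ?_) (zero_le)
      filter_upwards [hlim_fin, eventually_ge_atTop n] with m hm hnm
      refine X.qnorm_mono _ _ (hm.trans ENNReal.one_lt_top)
        (memL0_coe_real (((hSm n).sub hbm).max aemeasurable_const)) ?_
      filter_upwards [hFb] with x hx
      rw [hx, ← EReal.coe_sub, EReal.abs_def, EReal.abs_def]
      refine ENNReal.ofReal_le_ofReal ?_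
      rw [abs_of_nonneg (le_max_right _ _)]
      refine max_le ?_ (abs_nonneg _)
      refine le_trans ?_ (le_abs_self _)
      have : S n x ≤ S m x := Finset.sum_le_sum_of_subset_of_nonneg
        (Finset.range_mono hnm) (fun i _ _ => ENNReal.toReal_nonneg)
      linarith
    filter_upwards [(X.qnorm_eq_zero_iff _).1 hz] with x hx
    have : max (S n x - b x) 0 = 0 := EReal.coe_eq_zero.1 hx
    have := le_max_left (S n x - b x) 0
    linarith
  have hsum_le : ∀ᵐ x ∂μ, ∑' n, f n x ≤ ENNReal.ofReal (b x) := by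
    filter_upwards [ae_all_iff.2 hdom, hSf] with x hx hx2
    rw [ENNReal.tsum_eq_iSup_nat]
    exact iSup_le fun n => (hx2 n) ▸ ENNReal.ofReal_le_ofReal (hx n)
  have hbound : ∀ᶠ m in atTop, X.qnormNonneg (fun x => ∑' n, f n x) ≤
      K * (X.qnorm (fun x => ((S m x : ℝ) : EReal) - F x) + σ) := by
    filter_upwards [hlim_fin] with m hm
    have hm' := hm.trans ENNReal.one_lt_top
    refine (X.qnormNonneg_mono_ae (AEMeasurable.tsum hfm)
      (g := fun x => (((S m x : ℝ) : EReal) - F x).abs + ENNReal.ofReal (S m x)) ?_).trans ?_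
    · filter_upwards [hsum_le, hFb] with x hx hx2
      refine hx.trans ?_
      rw [hx2, ← EReal.coe_sub, EReal.abs_def, ← ENNReal.ofReal_add (abs_nonneg _) (hSnn m x)]
      refine ENNReal.ofReal_le_ofReal ?_
      have := neg_abs_le (S m x - b x)
      linarith
    · refine (hK _ _).trans ?_
      gcongr
      · exact X.qnormNonneg_abs hm'
      · exact hSσ m
  have hlim2 : Tendsto (fun m => (K : ℝ≥0∞) *
      (X.qnorm (fun x => ((S m x : ℝ) : EReal) - F x) + σ)) atTop (𝓝 (K * (0 + σ))) :=
    ENNReal.Tendsto.const_mul (hFlim.add_const σ) (Or.inr ENNReal.coe_ne_top)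
  simpa using ge_of_tendsto hlim2 hbound

/-- Absolute continuity of the quasinorm, applied to the superlevel sets of `g` itself. -/
theorem tendsto_qnormNonneg_indicator_lt (hX : X.AbsolutelyContinuous) {g : P → ℝ≥0∞}
    (hg : X.qnormNonneg g < ∞) :
    Tendsto (fun k : ℕ => X.qnormNonneg ({x | (k : ℝ≥0∞) < g x}.indicator g)) atTop (𝓝 0) := by
  have hgm := X.aemeasurable_of_qnormNonneg_lt_top hg
  have hmeas : ∀ k : ℕ, NullMeasurableSet {x | (k : ℝ≥0∞) < g x} μ := fun k =>
    nullMeasurableSet_lt aemeasurable_const hgm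
  have htop : NullMeasurableSet {x | g x = ⊤} μ := hgm.nullMeasurable (measurableSet_singleton _)
  have key := hX (fun x => (g x : EReal)) (fun k : ℕ => {x | (k : ℝ≥0∞) < g x} \ {x | g x = ⊤}) hg
    (fun k => (hmeas k).diff htop) (by
      intro k l hkl x hx
      exact ⟨lt_of_le_of_lt (Nat.cast_le.2 hkl) (mem_ofPred_eq ▸ hx.1), hx.2⟩) (by
      ext x
      simp only [mem_iInter, Set.mem_sdiff, mem_ofPred_eq, mem_empty_iff_false, iff_false, not_forall]
      by_cases hx : g x = ⊤
      · exact ⟨0, fun h => h.2 hx⟩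
      · obtain ⟨n, hn⟩ := ENNReal.exists_nat_gt hx
        exact ⟨n, fun h => absurd (h.1.trans hn) (lt_irrefl _)⟩)
  refine tendsto_of_tendsto_of_tendsto_of_le_of_le tendsto_const_nhds key (fun _ => zero_le) ?_
  intro k
  have : (({x | (k : ℝ≥0∞) < g x} \ {x | g x = ⊤}).indicator fun x => (g x : EReal)) =
      fun x => ((({x | (k : ℝ≥0∞) < g x} \ {x | g x = ⊤}).indicator g x : ℝ≥0∞) : EReal) := by
    funext x
    by_cases hx : x ∈ ({x | (k : ℝ≥0∞) < g x} \ {x | g x = ⊤}) <;> simp only [hx, indicator_of_mem,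
      indicator_of_notMem, not_false_eq_true, EReal.coe_ennreal_zero]
  change _ ≤ X.qnorm (({x | (k : ℝ≥0∞) < g x} \ {x | g x = ⊤}).indicator fun x => (g x : EReal))
  rw [this]
  refine X.qnormNonneg_mono_ae (hgm.indicator₀ (hmeas k)) ?_
  filter_upwards [X.ae_ne_top_of_qnormNonneg_lt_top hg] with x hx
  by_cases hxk : (k : ℝ≥0∞) < g x
  · rw [indicator_of_mem (s := {x | (k : ℝ≥0∞) < g x}) hxk, indicator_of_mem]
    exact ⟨hxk, hx⟩
  · rw [indicator_of_notMem (s := {x | (k : ℝ≥0∞) < g x}) hxk]; exact zero_le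

end QuasiBanachFunctionSpace

end Quasinorm

/-! ### Capacity through nonnegative functions -/

section Capacity

variable {P : Type*} [MetricSpace P] [MeasurableSpace P] {μ : Measure P}

/-- `h` is an `s`-gradient of the `[0, ∞]`-valued function `v`, on the set `A`: outside a null set,
`v` is finite on `A` and `v x ≤ v y + d(x,y)^s (h x + h y)` for `x, y ∈ A`. As `x` and `y` can be
exchanged, no absolute value is needed. -/
def IsNonnegSGradientOn (μ : Measure P) (s : ℝ) (A : Set P) (v h : P → ℝ≥0∞) : Prop :=
  ∃ N : Set P, μ N = 0 ∧ (∀ x ∈ A \ N, v x ≠ ⊤) ∧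
    ∀ x ∈ A \ N, ∀ y ∈ A \ N, v x ≤ v y + edist x y ^ s * (h x + h y)

theorem ofReal_abs_sub_toReal_le {a b e : ℝ≥0∞} (ha : a ≠ ⊤) (hb : b ≠ ⊤) (hab : a ≤ b + e)
    (hba : b ≤ a + e) : ENNReal.ofReal |a.toReal - b.toReal| ≤ e := by
  rcases eq_or_ne e ⊤ with rfl | he
  · exact le_top
  refine ENNReal.ofReal_le_of_le_toReal ?_
  have h1 := ENNReal.toReal_mono (ENNReal.add_ne_top.2 ⟨hb, he⟩) hab
  have h2 := ENNReal.toReal_mono (ENNReal.add_ne_top.2 ⟨ha, he⟩) hba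
  rw [ENNReal.toReal_add hb he] at h1
  rw [ENNReal.toReal_add ha he] at h2
  exact abs_le.2 ⟨by linarith, by linarith⟩

variable (X : QuasiBanachFunctionSpace μ) (s : ℝ)

theorem capacity_mono {E F : Set P} (h : E ⊆ F) : capacity X s E ≤ capacity X s F :=
  le_iInf₂ fun u hu => iInf₂_le u ⟨hu.1, by
    obtain ⟨U, hU, hF, h1⟩ := hu.2
    exact ⟨U, hU, h.trans hF, h1⟩⟩

variable {X s}

theorem capacity_le {v h : P → ℝ≥0∞} (hvh : IsNonnegSGradientOn μ s univ v h) {U E : Set P}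
    (hU : IsOpen U) (hE : E ⊆ U) (h1 : ∀ x ∈ U, 1 ≤ v x) :
    capacity X s E ≤ X.qnormNonneg v + X.qnormNonneg h := by
  by_cases hfin : X.qnormNonneg v + X.qnormNonneg h = ⊤
  · rw [hfin]; exact le_top
  obtain ⟨hvf, hhf⟩ := ENNReal.add_ne_top.1 hfin
  obtain ⟨N, hN, hvN, hgrad⟩ := hvh
  have hgr : IsSGradient μ s (fun x => (v x : EReal)) h := by
    refine ⟨X.aemeasurable_of_qnormNonneg_lt_top hhf.lt_top, N, hN, ?_, ?_⟩
    · intro x hx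
      exact ⟨by simpa using hvN x ⟨mem_univ _, hx⟩, EReal.coe_ennreal_ne_bot _⟩
    · intro x hx y hy
      have hx' : x ∈ univ \ N := ⟨mem_univ _, hx⟩
      have hy' : y ∈ univ \ N := ⟨mem_univ _, hy⟩
      simp only [EReal.toReal_coe_ennreal]
      refine ofReal_abs_sub_toReal_le (hvN x hx') (hvN y hy') (hgrad x hx' y hy') ?_
      rw [edist_comm, add_comm (h x)]
      exact hgrad y hy' x hx'
  have hle : homHajlaszNorm X s (fun x => (v x : EReal)) ≤ X.qnormNonneg h := iInf₂_le h hgr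
  have hadm : Admissible X s E (fun x => (v x : EReal)) := by
    refine ⟨⟨⟨X.memL0 _ hvf.lt_top, hle.trans_lt hhf.lt_top⟩, hvf.lt_top⟩, U, hU, hE, ?_⟩
    intro x hx
    beta_reduce
    exact_mod_cast h1 x hx
  refine (iInf₂_le _ hadm).trans ?_
  exact add_le_add le_rfl hle

theorem exists_of_capacity_lt {E : Set P} {ε : ℝ≥0∞} (h : capacity X s E < ε) :
    ∃ v g : P → ℝ≥0∞, IsNonnegSGradientOn μ s univ v g ∧
      X.qnormNonneg v + X.qnormNonneg g < ε ∧
      ∃ U : Set P, IsOpen U ∧ E ⊆ U ∧ ∀ x ∈ U, 1 ≤ v x := by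
  simp only [capacity, iInf_lt_iff] at h
  obtain ⟨u, ⟨⟨hu1, huX⟩, U, hU, hEU, hu⟩, hlt⟩ := h
  have huX' : X.qnorm u < ∞ := huX
  have hpos : homHajlaszNorm X s u < ε - X.qnorm u := by
    rw [lt_tsub_iff_left]; exact hlt
  simp only [homHajlaszNorm, iInf_lt_iff] at hpos
  obtain ⟨g, ⟨hgm, N, hN, hfin, hgrad⟩, hg⟩ := hpos
  have habs : ∀ x ∉ N, (u x).abs = ENNReal.ofReal |(u x).toReal| := fun x hx => by
    conv_lhs => rw [← EReal.coe_toReal (hfin x hx).1 (hfin x hx).2, EReal.abs_def]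
  refine ⟨fun x => (u x).abs, g, ⟨N, hN, ?_, ?_⟩, ?_, U, hU, hEU, ?_⟩
  · intro x hx
    beta_reduce
    rw [habs x hx.2]; exact ENNReal.ofReal_ne_top
  · intro x hx y hy
    refine le_trans ?_ (add_le_add le_rfl (hgrad x hx.2 y hy.2))
    beta_reduce
    rw [habs x hx.2, habs y hy.2, ← ENNReal.ofReal_add (abs_nonneg _) (abs_nonneg _)]
    refine ENNReal.ofReal_le_ofReal ?_
    have := abs_sub_abs_le_abs_sub (u x).toReal (u y).toReal
    linarith
  · exact lt_of_le_of_lt (add_le_add (X.qnormNonneg_abs huX') le_rfl) (lt_tsub_iff_left.1 hg)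
  · intro x hx
    have := hu x hx
    beta_reduce
    generalize u x = a at this ⊢
    induction a with
    | bot => simp
    | top => simp
    | coe r =>
      have h1 : (1 : ℝ) ≤ r := by exact_mod_cast this
      rw [EReal.abs_def, ← ENNReal.ofReal_one]
      exact ENNReal.ofReal_le_ofReal (h1.trans (le_abs_self r))

variable (X s)

theorem exists_capacity_iUnion_le : ∃ K : ℝ≥0, 1 ≤ K ∧ ∀ E : ℕ → Set P,
    capacity X s (⋃ n, E n) ≤ ∑' n, (K : ℝ≥0∞) ^ (n + 1) * capacity X s (E n) := by
  obtain ⟨K, hK1, hK⟩ := X.exists_qnormNonneg_tsum_le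
  refine ⟨K, hK1, fun E => ?_⟩
  have hK0 : (K : ℝ≥0∞) ≠ 0 := by
    have : (0 : ℝ≥0) < K := lt_of_lt_of_le one_pos hK1
    exact_mod_cast this.ne'
  rcases eq_or_ne (∑' n, (K : ℝ≥0∞) ^ (n + 1) * capacity X s (E n)) ⊤ with hσ | hσ
  · rw [hσ]; exact le_top
  refine ENNReal.le_of_forall_pos_le_add fun ε hε _ => ?_
  obtain ⟨δ, hδ, hδsum⟩ := ENNReal.exists_pos_sum_of_countable' (ε := ε)
    (by exact_mod_cast hε.ne') ℕ
  have hKp : ∀ n : ℕ, (K : ℝ≥0∞) ^ (n + 1) ≠ 0 := fun n => pow_ne_zero _ hK0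
  have hKt : ∀ n : ℕ, (K : ℝ≥0∞) ^ (n + 1) ≠ ⊤ := fun n => ENNReal.pow_ne_top ENNReal.coe_ne_top
  have hcap : ∀ n, capacity X s (E n) < capacity X s (E n) + δ n / (K : ℝ≥0∞) ^ (n + 1) := by
    intro n
    refine ENNReal.lt_add_right ?_ (ENNReal.div_pos (hδ n).ne' (hKt n)).ne'
    intro htop
    have := ENNReal.ne_top_of_tsum_ne_top hσ n
    rw [htop, ENNReal.mul_top (hKp n)] at this
    exact this rfl
  choose v g hvg hlt U hU hEU hv using fun n => exists_of_capacity_lt (hcap n)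
  have hfin : ∀ n, X.qnormNonneg (v n) < ∞ ∧ X.qnormNonneg (g n) < ∞ := fun n =>
    ⟨lt_of_le_of_lt le_self_add ((hlt n).trans_le le_top),
      lt_of_le_of_lt le_add_self ((hlt n).trans_le le_top)⟩
  have hvm := fun n => X.aemeasurable_of_qnormNonneg_lt_top (hfin n).1
  have hgm := fun n => X.aemeasurable_of_qnormNonneg_lt_top (hfin n).2
  have hsum : X.qnormNonneg (fun x => ∑' n, v n x) + X.qnormNonneg (fun x => ∑' n, g n x) ≤
      (∑' n, (K : ℝ≥0∞) ^ (n + 1) * capacity X s (E n)) + ε := by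
    calc _ ≤ (∑' n, (K : ℝ≥0∞) ^ (n + 1) * X.qnormNonneg (v n)) +
          ∑' n, (K : ℝ≥0∞) ^ (n + 1) * X.qnormNonneg (g n) := add_le_add (hK v hvm) (hK g hgm)
      _ = ∑' n, (K : ℝ≥0∞) ^ (n + 1) * (X.qnormNonneg (v n) + X.qnormNonneg (g n)) := by
        rw [← ENNReal.tsum_add]; simp only [mul_add]
      _ ≤ ∑' n, ((K : ℝ≥0∞) ^ (n + 1) * capacity X s (E n) + δ n) := by
        refine ENNReal.tsum_le_tsum fun n => ?_
        refine (mul_le_mul_right (hlt n).le _).trans ?_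
        rw [mul_add, ENNReal.mul_div_cancel (hKp n) (hKt n)]
      _ ≤ _ := by
        rw [ENNReal.tsum_add]
        exact add_le_add le_rfl hδsum.le
  have hsumfin : X.qnormNonneg (fun x => ∑' n, v n x) < ∞ :=
    lt_of_le_of_lt (le_self_add.trans hsum)
      (ENNReal.add_lt_top.2 ⟨hσ.lt_top, ENNReal.coe_lt_top⟩)
  have hgrad : IsNonnegSGradientOn μ s univ (fun x => ⨆ n, v n x) (fun x => ∑' n, g n x) := by
    choose N hN hvN hgr using hvg
    refine ⟨(⋃ n, N n) ∪ {x | ¬ (∑' n, v n x) ≠ ⊤}, ?_, ?_, ?_⟩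
    · refine measure_union_null (measure_iUnion_null hN) ?_
      exact X.ae_ne_top_of_qnormNonneg_lt_top hsumfin
    · rintro x ⟨-, hx⟩ htop
      refine hx (Or.inr (not_not.2 (top_le_iff.1 (htop ▸ ?_))))
      exact iSup_le fun n => ENNReal.le_tsum n
    · rintro x ⟨-, hx⟩ y ⟨-, hy⟩
      have hx' : ∀ n, x ∈ univ \ N n := fun n => ⟨mem_univ _, fun h => hx (Or.inl (mem_iUnion_of_mem n h))⟩
      have hy' : ∀ n, y ∈ univ \ N n := fun n => ⟨mem_univ _, fun h => hy (Or.inl (mem_iUnion_of_mem n h))⟩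
      refine iSup_le fun n => (hgr n x (hx' n) y (hy' n)).trans ?_
      gcongr
      · exact le_iSup (fun n => v n y) n
      · exact ENNReal.le_tsum n
      · exact ENNReal.le_tsum n
  refine (capacity_le (X := X) hgrad (isOpen_iUnion hU) (iUnion_mono hEU) ?_).trans ?_
  · intro x hx
    obtain ⟨n, hn⟩ := mem_iUnion.1 hx
    exact (hv n x hn).trans (le_iSup (fun n => v n x) n)
  · refine le_trans ?_ hsum
    gcongr
    exact X.qnormNonneg_mono_ae (AEMeasurable.iSup hvm)
      (Eventually.of_forall fun x => iSup_le fun n => ENNReal.le_tsum n)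

theorem capacity_empty : capacity X s ∅ = 0 := by
  refine le_antisymm ((capacity_le (X := X) (v := fun _ => 0) (h := fun _ => 0) (U := ∅)
    ⟨∅, measure_empty, by simp, by simp⟩ isOpen_empty subset_rfl (by simp)).trans ?_) zero_le
  simp [X.qnormNonneg_zero]

theorem capacity_iUnion_eq_zero {E : ℕ → Set P} (h : ∀ n, capacity X s (E n) = 0) :
    capacity X s (⋃ n, E n) = 0 := by
  obtain ⟨K, -, hK⟩ := exists_capacity_iUnion_le X s
  exact le_antisymm ((hK E).trans (by simp [h])) zero_le

theorem exists_capacity_union_le : ∃ K : ℝ≥0, ∀ E F : Set P,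
    capacity X s (E ∪ F) ≤ K * (capacity X s E + capacity X s F) := by
  obtain ⟨K, hK1, hK⟩ := exists_capacity_iUnion_le X s
  refine ⟨K ^ 2, fun E F => ?_⟩
  have h := hK (fun n => if n = 0 then E else if n = 1 then F else ∅)
  have hU : E ∪ F ⊆ ⋃ n : ℕ, (if n = 0 then E else if n = 1 then F else ∅) := by
    rintro x (hx | hx)
    · exact mem_iUnion.2 ⟨0, by simpa using hx⟩
    · exact mem_iUnion.2 ⟨1, by simpa using hx⟩
  refine (capacity_mono X s hU).trans (h.trans ?_)
  rw [tsum_eq_sum (s := Finset.range 2)]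
  · simp only [Finset.sum_range_succ, Finset.range_zero, Finset.sum_empty, zero_add, if_true,
      one_ne_zero, if_false, pow_one, ENNReal.coe_pow, mul_add]
    have : (K : ℝ≥0∞) ≤ K ^ 2 := by
      exact_mod_cast le_self_pow₀ hK1 two_ne_zero
    gcongr
  · intro n hn
    have h2 : 1 < n := by simpa using hn
    have h0 : n ≠ 0 := by omega
    have h1 : n ≠ 1 := by omega
    simp [h0, h1, capacity_empty]

end Capacity

/-! ### Localization by a cutoff function -/

section Cutoff

variable {P : Type*} [MetricSpace P]

/-- The cutoff function `min(1, 2 - d(x,x₀)/R)₊`, equal to `1` on `B(x₀,R)` and to `0` outside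
`B(x₀,2R)`. -/
noncomputable def cutoff (x₀ : P) (R : ℝ) (x : P) : ℝ≥0∞ :=
  ENNReal.ofReal (min 1 (2 - dist x x₀ / R))

variable {x₀ : P} {R : ℝ}

theorem cutoff_le_one (x : P) : cutoff x₀ R x ≤ 1 := by
  rw [cutoff, ← ENNReal.ofReal_one]
  exact ENNReal.ofReal_le_ofReal (min_le_left _ _)

theorem cutoff_eq_one (hR : 0 < R) {x : P} (hx : x ∈ ball x₀ R) : cutoff x₀ R x = 1 := by
  have : dist x x₀ / R ≤ 1 := (div_le_one hR).2 (mem_ball.1 hx).le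
  rw [cutoff, min_eq_left (by linarith), ENNReal.ofReal_one]

theorem cutoff_eq_zero (hR : 0 < R) {x : P} (hx : x ∉ ball x₀ (2 * R)) : cutoff x₀ R x = 0 := by
  have : 2 ≤ dist x x₀ / R := (le_div_iff₀ hR).2 (not_lt.1 (mt mem_ball.2 hx))
  exact ENNReal.ofReal_of_nonpos ((min_le_right _ _).trans (by linarith))

theorem continuous_cutoff : Continuous (cutoff x₀ R) :=
  ENNReal.continuous_ofReal.comp (by fun_prop)

theorem edist_rpow_eq {s : ℝ} (hs : 0 < s) (x y : P) :
    edist x y ^ s = ENNReal.ofReal (dist x y ^ s) := by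
  rw [edist_dist, ENNReal.ofReal_rpow_of_nonneg dist_nonneg hs.le]

/-- The cutoff function is Lipschitz and bounded by `1`, hence `s`-Hölder for `0 < s ≤ 1`. -/
theorem cutoff_le_add (hR : 0 < R) {s : ℝ} (hs0 : 0 < s) (hs1 : s ≤ 1) (x y : P) :
    cutoff x₀ R x ≤ cutoff x₀ R y + ENNReal.ofReal (R ^ (-s)) * edist x y ^ s := by
  rw [edist_rpow_eq hs0, ← ENNReal.ofReal_mul (by positivity)]
  have hd : 0 ≤ dist x y / R := by positivity
  have hpow : R ^ (-s) * dist x y ^ s = (dist x y / R) ^ s := by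
    rw [Real.div_rpow dist_nonneg hR.le, Real.rpow_neg hR.le]; field_simp
  rw [hpow]
  rcases le_total 1 (dist x y / R) with h1 | h1
  · refine (cutoff_le_one x).trans (le_trans ?_ le_add_self)
    rw [← ENNReal.ofReal_one]
    exact ENNReal.ofReal_le_ofReal (Real.one_le_rpow h1 hs0.le)
  · refine le_trans ?_ ENNReal.ofReal_add_le
    refine ENNReal.ofReal_le_ofReal ?_
    have h2 : dist x y / R ≤ (dist x y / R) ^ s := by
      rcases hd.eq_or_lt with h0 | h0
      · rw [← h0, Real.zero_rpow hs0.ne']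
      · simpa using Real.rpow_le_rpow_of_exponent_ge h0 h1 hs1
    have h3 : dist y x₀ / R ≤ dist x y / R + dist x x₀ / R := by
      rw [← add_div]
      gcongr
      rw [dist_comm x y]; exact dist_triangle y x x₀
    rcases min_cases 1 (2 - dist y x₀ / R) with h | h <;>
      rcases min_cases 1 (2 - dist x x₀ / R) with h' | h' <;> linarith

variable [MeasurableSpace P] {μ : Measure P}

/-- Leibniz rule for the product of a function with the cutoff function. Only a gradient on the
ball that carries the cutoff function is needed. -/
theorem IsNonnegSGradientOn.cutoff_mul {s : ℝ} (hs0 : 0 < s) (hs1 : s ≤ 1) (hR : 0 < R)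
    {v k : P → ℝ≥0∞} (h : IsNonnegSGradientOn μ s (ball x₀ (2 * R)) v k) :
    IsNonnegSGradientOn μ s univ (fun x => cutoff x₀ R x * v x)
      ((ball x₀ (2 * R)).indicator fun x => k x + ENNReal.ofReal (R ^ (-s)) * v x) := by
  obtain ⟨N, hN, hfin, hgr⟩ := h
  refine ⟨N, hN, ?_, ?_⟩
  · rintro x ⟨-, hx⟩
    by_cases hxB : x ∈ ball x₀ (2 * R)
    · exact ENNReal.mul_ne_top ((cutoff_le_one x).trans_lt ENNReal.one_lt_top).ne (hfin x ⟨hxB, hx⟩)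
    · simp [cutoff_eq_zero hR hxB]
  · rintro x ⟨-, hx⟩ y ⟨-, hy⟩
    by_cases hxB : x ∈ ball x₀ (2 * R)
    swap
    · simp [cutoff_eq_zero hR hxB]
    have hc := cutoff_le_add (x₀ := x₀) hR hs0 hs1 x y
    by_cases hyB : y ∈ ball x₀ (2 * R)
    · rw [indicator_of_mem hxB, indicator_of_mem hyB]
      calc cutoff x₀ R x * v x
          ≤ cutoff x₀ R x * (v y + edist x y ^ s * (k x + k y)) := by
            gcongr; exact hgr x ⟨hxB, hx⟩ y ⟨hyB, hy⟩
        _ = cutoff x₀ R x * v y + cutoff x₀ R x * (edist x y ^ s * (k x + k y)) := mul_add _ _ _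
        _ ≤ (cutoff x₀ R y + ENNReal.ofReal (R ^ (-s)) * edist x y ^ s) * v y +
            1 * (edist x y ^ s * (k x + k y)) := by
            gcongr; exact cutoff_le_one x
        _ = cutoff x₀ R y * v y +
            edist x y ^ s * (k x + (k y + ENNReal.ofReal (R ^ (-s)) * v y)) := by ring
        _ ≤ _ := by gcongr; exact le_self_add
    · beta_reduce
      rw [indicator_of_mem hxB, indicator_of_notMem hyB, cutoff_eq_zero hR hyB]
      rw [cutoff_eq_zero hR hyB, zero_add] at hc
      calc cutoff x₀ R x * v x ≤ ENNReal.ofReal (R ^ (-s)) * edist x y ^ s * v x := by gcongr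
        _ = edist x y ^ s * (ENNReal.ofReal (R ^ (-s)) * v x) := by ring
        _ ≤ _ := by
          rw [zero_mul, zero_add, add_zero]
          gcongr
          exact le_add_self

end Cutoff

/-! ### The Sobolev–Poincaré inequality at the critical exponent -/

section Poincare

variable {P : Type*} [MetricSpace P] [MeasurableSpace P] [BorelSpace P] {μ : Measure P}

omit [BorelSpace P] in
theorem LowerMassBound.exists_mul_le {Q : ℝ} (hμ : BallsPosFinite μ) (hμQ : LowerMassBound μ Q) :
    ∃ c : ℝ, 0 < c ∧ ∀ (x y : P) (r R : ℝ), 0 < r → r ≤ R → y ∈ ball x R →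
      ENNReal.ofReal (c * (r / R) ^ Q) * μ (ball x R) ≤ μ (ball y r) := by
  obtain ⟨c, hc, h⟩ := hμQ
  refine ⟨c, hc, fun x y r R hr hrR hy => ?_⟩
  have hb := hμ x R (hr.trans_le hrR)
  exact (ENNReal.le_div_iff_mul_le (Or.inl hb.1.ne') (Or.inl hb.2.ne)).1 (h x y r R hr hrR hy)

/-- Chebyshev's inequality: a ball of large measure contains a point at which `h` is small. -/
theorem exists_mem_ball_le {h : P → ℝ≥0∞} {N B : Set P} (hN : μ N = 0) {q : ℝ} (hq : 0 < q)
    {T τ : ℝ} (hT : 0 < T) (hτ : 0 < τ) (hint : ∫⁻ z in B, h z ^ q ∂μ ≤ ENNReal.ofReal (T ^ q) * μ B)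
    {y : P} {r : ℝ} (hsub : ball y r ⊆ B)
    (hlt : ENNReal.ofReal ((T / τ) ^ q) * μ B < μ (ball y r)) :
    ∃ z ∈ ball y r, z ∉ N ∧ h z ≤ ENNReal.ofReal τ := by
  by_contra! hcon
  have hτq : 0 < τ ^ q := Real.rpow_pos_of_pos hτ q
  have h1 : ENNReal.ofReal (τ ^ q) * μ (ball y r) ≤ ∫⁻ z in ball y r, h z ^ q ∂μ := by
    have hNae : ∀ᵐ z ∂μ, z ∉ N := measure_eq_zero_iff_ae_notMem.1 hN
    calc ENNReal.ofReal (τ ^ q) * μ (ball y r) = ∫⁻ _ in ball y r, ENNReal.ofReal (τ ^ q) ∂μ :=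
          (setLIntegral_const _ _).symm
      _ ≤ _ := by
        refine setLIntegral_mono_ae' measurableSet_ball ?_
        filter_upwards [hNae] with z hzN hz
        rw [← ENNReal.ofReal_rpow_of_pos hτ]
        exact ENNReal.rpow_le_rpow (hcon z hz hzN).le hq.le
  have h2 : ∫⁻ z in ball y r, h z ^ q ∂μ ≤ ∫⁻ z in B, h z ^ q ∂μ := lintegral_mono_set hsub
  have h3 : ENNReal.ofReal (T ^ q) = ENNReal.ofReal (τ ^ q) * ENNReal.ofReal ((T / τ) ^ q) := by
    rw [← ENNReal.ofReal_mul hτq.le, Real.div_rpow hT.le hτ.le]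
    congr 1; field_simp
  have h4 := (h1.trans h2).trans hint
  rw [h3, mul_assoc] at h4
  have hne : ENNReal.ofReal (τ ^ q) ≠ 0 := by simpa using hτq
  rw [ENNReal.mul_le_mul_iff_right hne ENNReal.ofReal_ne_top] at h4
  exact absurd hlt (not_lt.2 h4)


/-- The geometric scales of the chaining argument. The three identities express that
`q = Q / (Q + s)` is the exponent whose Sobolev conjugate is `1`. -/
theorem exists_scale {Q s : ℝ} (hQ : 0 < Q) (hs : 0 < s) : ∃ θ p : ℝ, 0 < θ ∧ θ < 1 ∧ 1 < p ∧
    θ ^ Q = p⁻¹ ∧ 2 * θ ^ s = p ∧ (2 : ℝ) ^ (Q / (Q + s)) = p := by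
  have hQs : 0 < Q + s := by linarith
  refine ⟨2 ^ (-(1 / (Q + s))), 2 ^ (Q / (Q + s)), by positivity, ?_, ?_, ?_, ?_, rfl⟩
  · exact Real.rpow_lt_one_of_one_lt_of_neg one_lt_two (by simpa using hQs)
  · exact Real.one_lt_rpow one_lt_two (by positivity)
  · rw [← Real.rpow_mul two_pos.le, ← Real.rpow_neg two_pos.le]
    congr 1; field_simp
  · rw [← Real.rpow_mul two_pos.le]
    nth_rewrite 1 [← Real.rpow_one 2]
    rw [← Real.rpow_add two_pos]
    congr 1; field_simp; ring

omit [MeasurableSpace P] [BorelSpace P] in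
theorem edist_rpow_mul_le {s : ℝ} (hs : 0 < s) {x y : P} {r : ℝ} (hd : dist x y ≤ r)
    {a b : ℝ≥0∞} {α β : ℝ} (hα : 0 ≤ α) (hβ : 0 ≤ β) (ha : a ≤ ENNReal.ofReal α)
    (hb : b ≤ ENNReal.ofReal β) :
    edist x y ^ s * (a + b) ≤ ENNReal.ofReal (r ^ s * (α + β)) := by
  have hr : 0 ≤ r := dist_nonneg.trans hd
  rw [edist_rpow_eq hs, ENNReal.ofReal_mul (by positivity), ENNReal.ofReal_add hα hβ]
  gcongr

omit [MeasurableSpace P] [BorelSpace P] in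
/-- Chaining: from a point `x` with `h x ≤ λ 2ⁿ` one reaches a point `z` with `h z ≤ λ` in `n`
steps, the step down from level `k + 1` having length at most `R (1 - θ) θ ^ k`. -/
theorem exists_chain {f h : P → ℝ≥0∞} {N : Set P} {s : ℝ} (hs : 0 < s)
    (hgrad : ∀ x ∉ N, ∀ y ∉ N, f x ≤ f y + edist x y ^ s * (h x + h y))
    {θ p : ℝ} (hθ0 : 0 < θ) (hθ1 : θ < 1) (hp : 1 < p) (hθp : 2 * θ ^ s = p)
    {x₀ : P} {R l : ℝ} (hR : 0 < R) (hl : 0 < l)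
    (hstep : ∀ (k : ℕ) (y : P), ball y (R * (1 - θ) * θ ^ k) ⊆ ball x₀ (2 * R) →
      y ∈ ball x₀ (2 * R) →
      ∃ z ∈ ball y (R * (1 - θ) * θ ^ k), z ∉ N ∧ h z ≤ ENNReal.ofReal (l * 2 ^ k)) (n : ℕ) :
    ∀ x ∉ N, dist x x₀ < R * (1 + θ ^ n) → h x ≤ ENNReal.ofReal (l * 2 ^ n) →
      ∃ z ∈ ball x₀ (2 * R), z ∉ N ∧ h z ≤ ENNReal.ofReal l ∧
        f x ≤ f z + ENNReal.ofReal (3 / (p - 1) * R ^ s * l * p ^ n) ∧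
        f z ≤ f x + ENNReal.ofReal (3 / (p - 1) * R ^ s * l * p ^ n) := by
  have hp1 : 0 < p - 1 := by linarith
  induction n with
  | zero =>
    intro x hx hd hhx
    refine ⟨x, ?_, hx, by simpa using hhx, le_self_add, le_self_add⟩
    rw [mem_ball]; simpa [← two_mul, mul_comm] using hd
  | succ n ih =>
    intro x hx hd hhx
    have hθn : 0 < θ ^ n := by positivity
    have hθn1 : θ ^ n ≤ 1 := pow_le_one₀ hθ0.le hθ1.le
    have hr : 0 < R * (1 - θ) * θ ^ n := by
      have : 0 < 1 - θ := by linarith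
      positivity
    have hdr : dist x x₀ + R * (1 - θ) * θ ^ n < R * (1 + θ ^ n) := by
      have : R * (1 + θ ^ (n + 1)) + R * (1 - θ) * θ ^ n = R * (1 + θ ^ n) := by ring
      linarith
    have h2R : R * (1 + θ ^ n) ≤ 2 * R := by nlinarith
    have hsub : ball x (R * (1 - θ) * θ ^ n) ⊆ ball x₀ (2 * R) :=
      ball_subset_ball' (by linarith)
    obtain ⟨x', hx'b, hx'N, hx'h⟩ := hstep n x hsub (hsub (mem_ball_self hr))
    rw [mem_ball] at hx'b
    obtain ⟨z, hz, hzN, hzh, h1, h2⟩ := ih x' hx'N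
      (by linarith [dist_triangle x' x x₀]) hx'h
    have hrs : (R * (1 - θ) * θ ^ n) ^ s ≤ R ^ s * (θ ^ n) ^ s := by
      rw [← Real.mul_rpow hR.le hθn.le]
      gcongr
      nlinarith
    have hpow : (θ ^ n) ^ s * 2 ^ n = p ^ n := by
      rw [← hθp, mul_pow, ← Real.rpow_natCast, ← Real.rpow_mul hθ0.le, mul_comm (n : ℝ) s,
        Real.rpow_mul hθ0.le, Real.rpow_natCast, mul_comm]
    have hcost : (R * (1 - θ) * θ ^ n) ^ s * (l * 2 ^ (n + 1) + l * 2 ^ n) ≤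
        3 * R ^ s * l * p ^ n := by
      calc _ ≤ R ^ s * (θ ^ n) ^ s * (l * 2 ^ (n + 1) + l * 2 ^ n) := by gcongr
        _ = 3 * R ^ s * l * ((θ ^ n) ^ s * 2 ^ n) := by ring
        _ = _ := by rw [hpow]
    have hd' : dist x x' ≤ R * (1 - θ) * θ ^ n := by rw [dist_comm]; exact hx'b.le
    have e1 := edist_rpow_mul_le hs hd' (by positivity) (by positivity) hhx hx'h
    have e1' := e1.trans (ENNReal.ofReal_le_ofReal hcost)
    have hsum : ENNReal.ofReal (3 / (p - 1) * R ^ s * l * p ^ n) +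
        ENNReal.ofReal (3 * R ^ s * l * p ^ n) =
        ENNReal.ofReal (3 / (p - 1) * R ^ s * l * p ^ (n + 1)) := by
      rw [← ENNReal.ofReal_add (by positivity) (by positivity)]
      congr 1
      field_simp
      ring
    refine ⟨z, hz, hzN, hzh, ?_, ?_⟩
    · rw [← hsum, ← add_assoc]
      exact (hgrad x hx x' hx'N).trans (add_le_add h1 e1')
    · refine h2.trans ?_
      rw [← hsum, add_comm (ENNReal.ofReal (3 / (p - 1) * R ^ s * l * p ^ n)), ← add_assoc]
      refine add_le_add ((hgrad x' hx'N x hx).trans (add_le_add le_rfl ?_)) le_rfl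
      rw [edist_comm, add_comm (h x')]
      exact e1'

/-- Pointwise form of the Sobolev–Poincaré inequality. At the critical exponent the chaining cost
of a point of level `λ 2ⁿ` is comparable to `(2 ^ q) ^ n`, hence to `h x ^ q`. -/
theorem exists_pointwise_poincare (hμ : BallsPosFinite μ) {Q s : ℝ} (hQ : 0 < Q)
    (hμQ : LowerMassBound μ Q) (hs : 0 < s) :
    ∃ C : ℝ, 0 < C ∧ ∀ (f h : P → ℝ≥0∞) (N : Set P), μ N = 0 → (∀ x ∉ N, h x ≠ ⊤) →
      (∀ x ∉ N, f x ≠ ⊤) →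
      (∀ x ∉ N, ∀ y ∉ N, f x ≤ f y + edist x y ^ s * (h x + h y)) →
      ∀ (x₀ : P) (R T : ℝ), 0 < R → 0 < T →
      ∫⁻ z in ball x₀ (2 * R), h z ^ (Q / (Q + s)) ∂μ ≤
        ENNReal.ofReal (T ^ (Q / (Q + s))) * μ (ball x₀ (2 * R)) →
      ∃ a : ℝ≥0∞, a ≠ ⊤ ∧ ∀ x ∈ ball x₀ R, x ∉ N →
        f x ≤ a + ENNReal.ofReal (C * R ^ s * T) *
          (1 + (ENNReal.ofReal (T ^ (Q / (Q + s))))⁻¹ * h x ^ (Q / (Q + s))) ∧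
        a ≤ f x + ENNReal.ofReal (C * R ^ s * T) *
          (1 + (ENNReal.ofReal (T ^ (Q / (Q + s))))⁻¹ * h x ^ (Q / (Q + s))) := by
  obtain ⟨c, hc, hmass⟩ := hμQ.exists_mul_le hμ
  obtain ⟨θ, p, hθ0, hθ1, hp, hθQ, hθs, h2q⟩ := exists_scale hQ hs
  set q := Q / (Q + s) with hqdef
  have hq : 0 < q := by positivity
  have hp0 : 0 < p := by linarith
  have hp1 : 0 < p - 1 := by linarith
  have hγ : 0 < 1 - θ := by linarith
  -- the threshold factor `Λ` makes the exceptional sets smaller than the balls of the chain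
  set κ : ℝ := c * ((1 - θ) / 2) ^ Q with hκ
  have hκ0 : 0 < κ := by positivity
  set Λ : ℝ := (κ / 2) ^ (-q⁻¹) with hΛ
  have hΛ0 : 0 < Λ := by positivity
  have hΛq : Λ ^ q = (κ / 2)⁻¹ := by
    rw [hΛ, ← Real.rpow_mul (by positivity), neg_mul, inv_mul_cancel₀ hq.ne', Real.rpow_neg_one]
  refine ⟨2 * 4 ^ s * Λ + 3 / (p - 1) * Λ + 3 / (p - 1) * Λ * p * (Λ ^ q)⁻¹, by positivity, ?_⟩
  intro f h N hN hhN hfN hgrad x₀ R T hR hT hint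
  set B := ball x₀ (2 * R) with hB
  have hBm := hμ x₀ (2 * R) (by positivity)
  have hTq : 0 < T ^ q := by positivity
  have hl : 0 < Λ * T := by positivity
  have hstep : ∀ (k : ℕ) (y : P), ball y (R * (1 - θ) * θ ^ k) ⊆ B → y ∈ B →
      ∃ z ∈ ball y (R * (1 - θ) * θ ^ k), z ∉ N ∧ h z ≤ ENNReal.ofReal (Λ * T * 2 ^ k) := by
    intro k y hsub hy
    have hθk : 0 < θ ^ k := by positivity
    have hθk1 : θ ^ k ≤ 1 := pow_le_one₀ hθ0.le hθ1.le
    refine exists_mem_ball_le hN hq hT (by positivity) hint hsub ?_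
    refine lt_of_lt_of_le ?_ (hmass x₀ y (R * (1 - θ) * θ ^ k) (2 * R) (by positivity) ?_ hy)
    · rw [ENNReal.mul_lt_mul_iff_left hBm.1.ne' hBm.2.ne]
      rw [ENNReal.ofReal_lt_ofReal_iff (by positivity)]
      have e1 : (T / (Λ * T * 2 ^ k)) ^ q = κ / 2 * (p ^ k)⁻¹ := by
        have : T / (Λ * T * 2 ^ k) = Λ⁻¹ * (2 ^ k)⁻¹ := by field_simp
        rw [this, Real.mul_rpow (by positivity) (by positivity), Real.inv_rpow hΛ0.le, hΛq,
          inv_inv, Real.inv_rpow (by positivity), ← Real.rpow_natCast, ← Real.rpow_mul two_pos.le,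
          mul_comm (k : ℝ) q, Real.rpow_mul two_pos.le, h2q, Real.rpow_natCast]
      have e2 : c * (R * (1 - θ) * θ ^ k / (2 * R)) ^ Q = κ * (p ^ k)⁻¹ := by
        have : R * (1 - θ) * θ ^ k / (2 * R) = (1 - θ) / 2 * θ ^ k := by field_simp
        rw [this, Real.mul_rpow (by positivity) (by positivity), ← Real.rpow_natCast θ,
          ← Real.rpow_mul hθ0.le, mul_comm (k : ℝ) Q, Real.rpow_mul hθ0.le, hθQ, Real.rpow_natCast,
          hκ, inv_pow]
        ring
      rw [e1, e2]
      have : 0 < (p ^ k)⁻¹ := by positivity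
      nlinarith
    · calc R * (1 - θ) * θ ^ k ≤ R * 1 * 1 := by gcongr; linarith
        _ ≤ 2 * R := by linarith
  -- the centre value is taken at a point of level `0`
  obtain ⟨z₀, hz₀, hz₀N, hz₀h⟩ := hstep 0 x₀
    (ball_subset_ball (by nlinarith [pow_zero θ])) (mem_ball_self (by positivity))
  have hz₀B : z₀ ∈ B := ball_subset_ball (by nlinarith [pow_zero θ]) hz₀
  rw [pow_zero, mul_one] at hz₀h
  refine ⟨f z₀, hfN z₀ hz₀N, fun x hx hxN => ?_⟩
  have main : ∀ (n : ℕ) (E : ℝ≥0∞), h x ≤ ENNReal.ofReal (Λ * T * 2 ^ n) →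
      ENNReal.ofReal (2 * 4 ^ s * Λ * R ^ s * T + 3 / (p - 1) * Λ * R ^ s * T * p ^ n) ≤ E →
      f x ≤ f z₀ + E ∧ f z₀ ≤ f x + E := by
    intro n E hhx hE
    obtain ⟨z, hz, hzN, hzh, h1, h2⟩ := exists_chain hs hgrad hθ0 hθ1 hp hθs hR hl hstep n x hxN
      (by
        have : 0 < θ ^ n := by positivity
        rw [mem_ball] at hx; nlinarith) hhx
    have hd : dist z z₀ ≤ 4 * R := by
      have h3 := mem_ball.1 hz
      have h4 := mem_ball.1 hz₀B
      linarith [dist_triangle_right z z₀ x₀]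
    have e0 := edist_rpow_mul_le hs hd hl.le hl.le hzh hz₀h
    have e0' : ENNReal.ofReal ((4 * R) ^ s * (Λ * T + Λ * T)) =
        ENNReal.ofReal (2 * 4 ^ s * Λ * R ^ s * T) := by
      rw [Real.mul_rpow (by norm_num) hR.le]; congr 1; ring
    rw [e0'] at e0
    have e1 : ENNReal.ofReal (2 * 4 ^ s * Λ * R ^ s * T) +
        ENNReal.ofReal (3 / (p - 1) * R ^ s * (Λ * T) * p ^ n) ≤ E := by
      rw [← ENNReal.ofReal_add (by positivity) (by positivity)]
      refine le_trans (le_of_eq ?_) hE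
      congr 1; ring
    constructor
    · calc f x ≤ f z + ENNReal.ofReal (3 / (p - 1) * R ^ s * (Λ * T) * p ^ n) := h1
        _ ≤ f z₀ + ENNReal.ofReal (2 * 4 ^ s * Λ * R ^ s * T) +
            ENNReal.ofReal (3 / (p - 1) * R ^ s * (Λ * T) * p ^ n) := by
          gcongr
          exact (hgrad z hzN z₀ hz₀N).trans (by gcongr)
        _ ≤ f z₀ + E := by rw [add_assoc]; gcongr
    · have e0'' : edist z₀ z ^ s * (h z₀ + h z) ≤ ENNReal.ofReal (2 * 4 ^ s * Λ * R ^ s * T) := by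
        rw [edist_comm, add_comm (h z₀)]; exact e0
      calc f z₀ ≤ f z + ENNReal.ofReal (2 * 4 ^ s * Λ * R ^ s * T) :=
            (hgrad z₀ hz₀N z hzN).trans (by gcongr)
        _ ≤ f x + ENNReal.ofReal (3 / (p - 1) * R ^ s * (Λ * T) * p ^ n) +
            ENNReal.ofReal (2 * 4 ^ s * Λ * R ^ s * T) := by gcongr
        _ ≤ f x + E := by
          rw [add_assoc, add_comm (ENNReal.ofReal (3 / (p - 1) * R ^ s * (Λ * T) * p ^ n))]
          gcongr
  have hhx : h x = ENNReal.ofReal (h x).toReal := (ENNReal.ofReal_toReal (hhN x hxN)).symm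
  set ξ := (h x).toReal with hξ
  have hξ0 : 0 ≤ ξ := ENNReal.toReal_nonneg
  have hTinv : (ENNReal.ofReal (T ^ q))⁻¹ * h x ^ q = ENNReal.ofReal ((T ^ q)⁻¹ * ξ ^ q) := by
    rw [hhx, ENNReal.ofReal_rpow_of_nonneg hξ0 hq.le, ENNReal.ofReal_mul (by positivity),
      ENNReal.ofReal_inv_of_pos hTq]
  rw [hTinv, ← ENNReal.ofReal_one, ← ENNReal.ofReal_add zero_le_one (by positivity),
    ← ENNReal.ofReal_mul (by positivity)]
  set K := 3 / (p - 1) * Λ with hK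
  have hK0 : 0 < K := by positivity
  set D := 2 * 4 ^ s * Λ with hD
  have hD0 : 0 < D := by positivity
  have hRT : 0 < R ^ s * T := by positivity
  rcases le_or_gt ξ (Λ * T) with hle | hgt
  · refine main 0 _ ?_ (ENNReal.ofReal_le_ofReal ?_)
    · rw [hhx, pow_zero, mul_one]; exact ENNReal.ofReal_le_ofReal hle
    · have h3 : 0 ≤ K * p * (Λ ^ q)⁻¹ := by positivity
      have hw0 : 0 ≤ (T ^ q)⁻¹ * ξ ^ q := by positivity
      have h4 : D + K ≤ (D + K + K * p * (Λ ^ q)⁻¹) * (1 + (T ^ q)⁻¹ * ξ ^ q) := by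
        have : 0 ≤ (D + K + K * p * (Λ ^ q)⁻¹) * ((T ^ q)⁻¹ * ξ ^ q) := by positivity
        linarith
      calc D * R ^ s * T + K * R ^ s * T * p ^ 0 = (D + K) * (R ^ s * T) := by ring
        _ ≤ (D + K + K * p * (Λ ^ q)⁻¹) * (1 + (T ^ q)⁻¹ * ξ ^ q) * (R ^ s * T) := by gcongr
        _ = _ := by ring
  · obtain ⟨n, hn1, hn2⟩ := exists_nat_pow_near (x := ξ / (Λ * T)) (y := (2 : ℝ))
      ((one_le_div hl).2 hgt.le) one_lt_two
    refine main (n + 1) _ ?_ (ENNReal.ofReal_le_ofReal ?_)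
    · rw [hhx]
      refine ENNReal.ofReal_le_ofReal ?_
      rw [div_lt_iff₀ hl] at hn2
      linarith
    · have hpn : p ^ n ≤ (Λ ^ q)⁻¹ * ((T ^ q)⁻¹ * ξ ^ q) := by
        have h1 : ((2 : ℝ) ^ n) ^ q ≤ (ξ / (Λ * T)) ^ q := by gcongr
        rw [← Real.rpow_natCast, ← Real.rpow_mul two_pos.le, mul_comm (n : ℝ) q,
          Real.rpow_mul two_pos.le, h2q, Real.rpow_natCast, Real.div_rpow hξ0 hl.le,
          Real.mul_rpow hΛ0.le hT.le] at h1
        refine h1.trans (le_of_eq ?_)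
        field_simp
      set w := (T ^ q)⁻¹ * ξ ^ q with hw
      have hw0 : 0 ≤ w := by positivity
      calc D * R ^ s * T + K * R ^ s * T * p ^ (n + 1)
          = (D + K * p * p ^ n) * (R ^ s * T) := by ring
        _ ≤ (D + K * p * ((Λ ^ q)⁻¹ * w)) * (R ^ s * T) := by gcongr
        _ ≤ ((D + K + K * p * (Λ ^ q)⁻¹) * (1 + w)) * (R ^ s * T) := by
          gcongr
          have h3 : 0 ≤ K * p * (Λ ^ q)⁻¹ := by positivity
          have h4 : 0 ≤ (D + K) * w := by positivity
          nlinarith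
        _ = _ := by ring

/-- Sobolev–Poincaré inequality with exponents `q = Q / (Q + s)` and `1`, together with the
pointwise estimate at the points where the gradient is at most `T`, a bound for its `q`-mean. -/
theorem exists_sobolev_poincare (hμ : BallsPosFinite μ) {Q s : ℝ} (hQ : 0 < Q)
    (hμQ : LowerMassBound μ Q) (hs : 0 < s) :
    ∃ C : ℝ, 0 < C ∧ ∀ (f h : P → ℝ≥0∞) (N : Set P), μ N = 0 → (∀ x ∉ N, h x ≠ ⊤) →
      (∀ x ∉ N, f x ≠ ⊤) →
      (∀ x ∉ N, ∀ y ∉ N, f x ≤ f y + edist x y ^ s * (h x + h y)) →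
      ∀ (x₀ : P) (R T : ℝ), 0 < R → 0 < T →
      ∫⁻ z in ball x₀ (2 * R), h z ^ (Q / (Q + s)) ∂μ ≤
        ENNReal.ofReal (T ^ (Q / (Q + s))) * μ (ball x₀ (2 * R)) →
      ∃ a : ℝ≥0∞, a ≠ ⊤ ∧
        ∫⁻ z in ball x₀ R, (f z - a) ∂μ ≤ ENNReal.ofReal (C * R ^ s * T) * μ (ball x₀ (2 * R)) ∧
        ∫⁻ z in ball x₀ R, (a - f z) ∂μ ≤ ENNReal.ofReal (C * R ^ s * T) * μ (ball x₀ (2 * R)) ∧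
        ∀ x ∈ ball x₀ R, x ∉ N → h x ≤ ENNReal.ofReal T →
          f x ≤ a + ENNReal.ofReal (C * R ^ s * T) ∧ a ≤ f x + ENNReal.ofReal (C * R ^ s * T) := by
  obtain ⟨C, hC, H⟩ := exists_pointwise_poincare hμ hQ hμQ hs
  set q := Q / (Q + s) with hqdef
  have hq : 0 < q := by positivity
  refine ⟨2 * C, by positivity, ?_⟩
  intro f h N hN hhN hfN hgrad x₀ R T hR hT hint
  obtain ⟨a, ha, hfa⟩ := H f h N hN hhN hfN hgrad x₀ R T hR hT hint
  have hTq : 0 < T ^ q := by positivity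
  have hTq0 : ENNReal.ofReal (T ^ q) ≠ 0 := by simpa using hTq
  have h2C : ENNReal.ofReal (2 * C * R ^ s * T) = ENNReal.ofReal (C * R ^ s * T) * 2 := by
    rw [show 2 * C * R ^ s * T = C * R ^ s * T * 2 by ring, ENNReal.ofReal_mul (by positivity)]
    simp
  have hNae : ∀ᵐ z ∂μ, z ∉ N := measure_eq_zero_iff_ae_notMem.1 hN
  have hE : ∫⁻ z in ball x₀ R, ENNReal.ofReal (C * R ^ s * T) *
      (1 + (ENNReal.ofReal (T ^ q))⁻¹ * h z ^ q) ∂μ ≤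
      ENNReal.ofReal (2 * C * R ^ s * T) * μ (ball x₀ (2 * R)) := by
    rw [lintegral_const_mul' _ _ ENNReal.ofReal_ne_top, lintegral_add_left measurable_const,
      lintegral_const_mul' _ _ (ENNReal.inv_ne_top.2 hTq0), h2C, mul_assoc (ENNReal.ofReal _) 2]
    gcongr
    rw [setLIntegral_const, one_mul, two_mul]
    have hsub : ball x₀ R ⊆ ball x₀ (2 * R) := ball_subset_ball (by linarith)
    gcongr
    calc (ENNReal.ofReal (T ^ q))⁻¹ * ∫⁻ z in ball x₀ R, h z ^ q ∂μ
        ≤ (ENNReal.ofReal (T ^ q))⁻¹ * (ENNReal.ofReal (T ^ q) * μ (ball x₀ (2 * R))) := by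
          gcongr
          exact (lintegral_mono_set hsub).trans hint
      _ = μ (ball x₀ (2 * R)) := by
          rw [← mul_assoc, ENNReal.inv_mul_cancel hTq0 ENNReal.ofReal_ne_top, one_mul]
  refine ⟨a, ha, le_trans ?_ hE, le_trans ?_ hE, ?_⟩
  · refine setLIntegral_mono_ae' measurableSet_ball ?_
    filter_upwards [hNae] with z hzN hz
    exact tsub_le_iff_left.2 (hfa z hz hzN).1
  · refine setLIntegral_mono_ae' measurableSet_ball ?_
    filter_upwards [hNae] with z hzN hz
    exact tsub_le_iff_left.2 (hfa z hz hzN).2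
  · intro x hx hxN hhx
    have hE2 : ENNReal.ofReal (C * R ^ s * T) * (1 + (ENNReal.ofReal (T ^ q))⁻¹ * h x ^ q) ≤
        ENNReal.ofReal (2 * C * R ^ s * T) := by
      rw [h2C]
      gcongr
      rw [← one_add_one_eq_two]
      gcongr
      calc (ENNReal.ofReal (T ^ q))⁻¹ * h x ^ q
          ≤ (ENNReal.ofReal (T ^ q))⁻¹ * ENNReal.ofReal (T ^ q) := by
            gcongr
            rw [← ENNReal.ofReal_rpow_of_pos hT]
            exact ENNReal.rpow_le_rpow hhx hq.le
        _ = 1 := ENNReal.inv_mul_cancel hTq0 ENNReal.ofReal_ne_top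
    exact ⟨(hfa x hx hxN).1.trans (by gcongr), (hfa x hx hxN).2.trans (by gcongr)⟩

end Poincare

/-! ### Smooth averages and their maximal function -/

section SmoothAverage

variable {P : Type*} [MetricSpace P]

/-- The kernel `(2 - d(x,z)/ρ)₊`. It is at least `1` on `B(x,ρ)`, vanishes outside `B(x,2ρ)`, and
is Lipschitz in `x`. -/
noncomputable def averagingKernel (ρ : ℝ) (x z : P) : ℝ≥0∞ := ENNReal.ofReal (2 - dist x z / ρ)

variable {ρ : ℝ}

theorem averagingKernel_le_two (hρ : 0 < ρ) (x z : P) : averagingKernel ρ x z ≤ 2 := by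
  have : 0 ≤ dist x z / ρ := by positivity
  calc averagingKernel ρ x z ≤ ENNReal.ofReal 2 := ENNReal.ofReal_le_ofReal (by linarith)
    _ = 2 := by simp

theorem averagingKernel_eq_zero (hρ : 0 < ρ) {x z : P} (h : z ∉ ball x (2 * ρ)) :
    averagingKernel ρ x z = 0 := by
  have : 2 ≤ dist x z / ρ := by
    rw [le_div_iff₀ hρ, dist_comm]
    exact not_lt.1 (mt mem_ball.2 h)
  exact ENNReal.ofReal_of_nonpos (by linarith)

theorem one_le_averagingKernel (hρ : 0 < ρ) {x z : P} (h : z ∈ ball x ρ) :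
    1 ≤ averagingKernel ρ x z := by
  have : dist x z / ρ ≤ 1 := by
    rw [div_le_one hρ, dist_comm]
    exact (mem_ball.1 h).le
  rw [averagingKernel, ← ENNReal.ofReal_one]
  exact ENNReal.ofReal_le_ofReal (by linarith)

theorem averagingKernel_le_add (hρ : 0 < ρ) (x y z : P) :
    averagingKernel ρ x z ≤ averagingKernel ρ y z + ENNReal.ofReal (dist x y / ρ) := by
  refine le_trans (ENNReal.ofReal_le_ofReal ?_) ENNReal.ofReal_add_le
  have : dist y z / ρ ≤ dist x y / ρ + dist x z / ρ := by
    rw [← add_div]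
    gcongr
    rw [dist_comm x y]; exact dist_triangle y x z
  linarith

theorem continuous_averagingKernel (x : P) : Continuous (averagingKernel ρ x) :=
  ENNReal.continuous_ofReal.comp (by fun_prop)

theorem continuous_averagingKernel_left (z : P) : Continuous fun x => averagingKernel ρ x z :=
  ENNReal.continuous_ofReal.comp (by fun_prop)

variable [MeasurableSpace P] {μ : Measure P}

/-- The average of `f` around `x` with respect to the averaging kernel. -/
noncomputable def smoothAverage (μ : Measure P) (ρ : ℝ) (f : P → ℝ≥0∞) (x : P) : ℝ≥0∞ :=
  (∫⁻ z, averagingKernel ρ x z * f z ∂μ) / ∫⁻ z, averagingKernel ρ x z ∂μ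

variable [BorelSpace P]

theorem aemeasurable_averagingKernel_mul {f : P → ℝ≥0∞} (hf : AEMeasurable f μ) (x : P) :
    AEMeasurable (fun z => averagingKernel ρ x z * f z) μ :=
  (continuous_averagingKernel x).measurable.aemeasurable.mul hf

theorem lintegral_averagingKernel_mul_le (hρ : 0 < ρ) (x : P) (f : P → ℝ≥0∞) {B : Set P}
    (hB : ball x (2 * ρ) ⊆ B) :
    ∫⁻ z, averagingKernel ρ x z * f z ∂μ ≤ 2 * ∫⁻ z in B, f z ∂μ := by
  refine le_trans ?_ (mul_le_mul_right (lintegral_mono_set hB) 2)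
  rw [← lintegral_const_mul' _ _ ENNReal.ofNat_ne_top, ← lintegral_indicator measurableSet_ball]
  refine lintegral_mono fun z => ?_
  by_cases hz : z ∈ ball x (2 * ρ)
  · rw [indicator_of_mem hz]
    gcongr
    exact averagingKernel_le_two hρ x z
  · simp [averagingKernel_eq_zero hρ hz]

theorem setLIntegral_le_lintegral_averagingKernel_mul (hρ : 0 < ρ) (x : P) (f : P → ℝ≥0∞) :
    ∫⁻ z in ball x ρ, f z ∂μ ≤ ∫⁻ z, averagingKernel ρ x z * f z ∂μ := by
  rw [← lintegral_indicator measurableSet_ball]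
  refine lintegral_mono fun z => ?_
  by_cases hz : z ∈ ball x ρ
  · rw [indicator_of_mem hz]
    exact le_mul_of_one_le_left zero_le (one_le_averagingKernel hρ hz)
  · simp [hz]

theorem measure_ball_le_lintegral_averagingKernel (hρ : 0 < ρ) (x : P) :
    μ (ball x ρ) ≤ ∫⁻ z, averagingKernel ρ x z ∂μ := by
  simpa using setLIntegral_le_lintegral_averagingKernel_mul (μ := μ) hρ x (fun _ => 1)

theorem lintegral_averagingKernel_le (hρ : 0 < ρ) (x : P) :
    ∫⁻ z, averagingKernel ρ x z ∂μ ≤ 2 * μ (ball x (2 * ρ)) := by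
  simpa using lintegral_averagingKernel_mul_le (μ := μ) hρ x (fun _ => 1) subset_rfl

theorem lintegral_averagingKernel_ne_zero (hμ : BallsPosFinite μ) (hρ : 0 < ρ) (x : P) :
    ∫⁻ z, averagingKernel ρ x z ∂μ ≠ 0 :=
  ((hμ x ρ hρ).1.trans_le (measure_ball_le_lintegral_averagingKernel hρ x)).ne'

theorem lintegral_averagingKernel_ne_top (hμ : BallsPosFinite μ) (hρ : 0 < ρ) (x : P) :
    ∫⁻ z, averagingKernel ρ x z ∂μ ≠ ⊤ :=
  ((lintegral_averagingKernel_le hρ x).trans_lt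
    (ENNReal.mul_lt_top (by simp) (hμ x _ (by positivity)).2)).ne

theorem smoothAverage_const (hμ : BallsPosFinite μ) (hρ : 0 < ρ) (a : ℝ≥0∞) (x : P) :
    smoothAverage μ ρ (fun _ => a) x = a := by
  rw [smoothAverage, lintegral_mul_const _ (continuous_averagingKernel x).measurable, mul_comm]
  exact ENNReal.mul_div_cancel_right (lintegral_averagingKernel_ne_zero hμ hρ x)
    (lintegral_averagingKernel_ne_top hμ hρ x)

theorem smoothAverage_add {f : P → ℝ≥0∞} (hf : AEMeasurable f μ) (g : P → ℝ≥0∞) (x : P) :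
    smoothAverage μ ρ (fun z => f z + g z) x = smoothAverage μ ρ f x + smoothAverage μ ρ g x := by
  simp only [smoothAverage, mul_add]
  rw [lintegral_add_left' (aemeasurable_averagingKernel_mul hf x),
    ENNReal.add_div]

/-- A function and its positive and negative deviations from a constant. -/
theorem smoothAverage_add_tsub (hμ : BallsPosFinite μ) (hρ : 0 < ρ) {f : P → ℝ≥0∞}
    (hf : AEMeasurable f μ) (a : ℝ≥0∞) (x : P) :
    smoothAverage μ ρ f x + smoothAverage μ ρ (fun z => a - f z) x =
      a + smoothAverage μ ρ (fun z => f z - a) x := by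
  rw [← smoothAverage_add hf]
  have hc := smoothAverage_add (ρ := ρ) (μ := μ) (f := fun _ => a) aemeasurable_const
    (fun z => f z - a) x
  rw [smoothAverage_const hμ hρ] at hc
  rw [← hc]
  congr 1; funext z
  rw [add_tsub_eq_max, add_tsub_eq_max, max_comm]

theorem smoothAverage_le (hρ : 0 < ρ) (f : P → ℝ≥0∞) {x : P} {B : Set P}
    (hB : ball x (2 * ρ) ⊆ B) {m D : ℝ≥0∞} (hm : m ≠ 0) (hmt : m ≠ ⊤)
    (hD : m ≤ D * μ (ball x ρ)) :
    smoothAverage μ ρ f x ≤ 2 * D * ((∫⁻ z in B, f z ∂μ) / m) := by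
  refine ENNReal.div_le_of_le_mul ?_
  calc ∫⁻ z, averagingKernel ρ x z * f z ∂μ ≤ 2 * ∫⁻ z in B, f z ∂μ :=
        lintegral_averagingKernel_mul_le hρ x f hB
    _ = 2 * ((∫⁻ z in B, f z ∂μ) / m) * m := by
        rw [mul_assoc, ENNReal.div_mul_cancel hm hmt]
    _ ≤ 2 * ((∫⁻ z in B, f z ∂μ) / m) * (D * ∫⁻ z, averagingKernel ρ x z ∂μ) := by
        gcongr
        exact hD.trans (by gcongr; exact measure_ball_le_lintegral_averagingKernel hρ x)
    _ = _ := by ring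

theorem lintegral_averagingKernel_mul_le_add (hρ : 0 < ρ) {x : P} (y : P) {f : P → ℝ≥0∞}
    (hf : AEMeasurable f μ) {B : Set P} (hBm : MeasurableSet B) (hB : ball x (2 * ρ) ⊆ B) :
    ∫⁻ z, averagingKernel ρ x z * f z ∂μ ≤ ∫⁻ z, averagingKernel ρ y z * f z ∂μ +
      ENNReal.ofReal (dist x y / ρ) * ∫⁻ z in B, f z ∂μ := by
  rw [← lintegral_const_mul' _ _ ENNReal.ofReal_ne_top, ← lintegral_indicator hBm,
    ← lintegral_add_left' (aemeasurable_averagingKernel_mul hf y)]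
  refine lintegral_mono fun z => ?_
  by_cases hz : z ∈ B
  · rw [indicator_of_mem hz, ← add_mul]
    gcongr
    exact averagingKernel_le_add hρ x y z
  · simp [averagingKernel_eq_zero hρ (fun h => hz (hB h))]

/-- Smooth averages of `f` depend on the centre in a Lipschitz way, with a constant controlled by
the mean value of `f`. -/
theorem smoothAverage_le_add (hμ : BallsPosFinite μ) (hρ : 0 < ρ) {f : P → ℝ≥0∞}
    (hf : AEMeasurable f μ) {x y : P} {B : Set P} (hBm : MeasurableSet B)
    (hx : ball x (2 * ρ) ⊆ B) (hy : ball y (2 * ρ) ⊆ B) {m D : ℝ≥0∞} (hm : m ≠ 0) (hmt : m ≠ ⊤)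
    (hBmeas : μ B ≤ m) (hDx : m ≤ D * μ (ball x ρ)) (hDy : m ≤ D * μ (ball y ρ)) :
    smoothAverage μ ρ f x ≤ smoothAverage μ ρ f y +
      ENNReal.ofReal (dist x y / ρ) * (D + 2 * D ^ 2) * ((∫⁻ z in B, f z ∂μ) / m) := by
  set I := (∫⁻ z in B, f z ∂μ) / m with hI
  set ε := ENNReal.ofReal (dist x y / ρ) with hε
  set Ψx := ∫⁻ z, averagingKernel ρ x z ∂μ with hΨx
  set Ψy := ∫⁻ z, averagingKernel ρ y z ∂μ with hΨy
  have hImul : ∫⁻ z in B, f z ∂μ = I * m := (ENNReal.div_mul_cancel hm hmt).symm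
  have hmD : m ≤ D * Ψx :=
    hDx.trans (by gcongr; exact measure_ball_le_lintegral_averagingKernel hρ x)
  have hΨ : Ψy ≤ Ψx + ε * m := by
    have := lintegral_averagingKernel_mul_le_add (μ := μ) hρ (x := y) x (f := fun _ => 1)
      aemeasurable_const hBm hy
    simp only [mul_one, setLIntegral_const, one_mul, dist_comm y x] at this
    exact this.trans (by gcongr)
  have hSy : smoothAverage μ ρ f y ≤ 2 * D * I := smoothAverage_le hρ f hy hm hmt hDy
  refine ENNReal.div_le_of_le_mul ?_
  calc ∫⁻ z, averagingKernel ρ x z * f z ∂μ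
      ≤ ∫⁻ z, averagingKernel ρ y z * f z ∂μ + ε * ∫⁻ z in B, f z ∂μ :=
        lintegral_averagingKernel_mul_le_add hρ y hf hBm hx
    _ = smoothAverage μ ρ f y * Ψy + ε * (I * m) := by
        rw [hImul, smoothAverage, ENNReal.div_mul_cancel
          (lintegral_averagingKernel_ne_zero hμ hρ y) (lintegral_averagingKernel_ne_top hμ hρ y)]
    _ ≤ smoothAverage μ ρ f y * (Ψx + ε * (D * Ψx)) + ε * (I * (D * Ψx)) := by
        gcongr
        exact hΨ.trans (by gcongr)
    _ = smoothAverage μ ρ f y * Ψx + (smoothAverage μ ρ f y * D + I * D) * ε * Ψx := by ring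
    _ ≤ smoothAverage μ ρ f y * Ψx + (2 * D * I * D + I * D) * ε * Ψx := by gcongr
    _ = _ := by ring

/-- If `f` has mean deviation at most `E` from the constant `a` on `B`, then nearby smooth averages
of `f` differ by at most a multiple of `E`. -/
theorem smoothAverage_le_add_of_deviation (hμ : BallsPosFinite μ) (hρ : 0 < ρ) {f : P → ℝ≥0∞}
    (hf : AEMeasurable f μ) {x y : P} {B : Set P} (hBm : MeasurableSet B)
    (hx : ball x (2 * ρ) ⊆ B) (hy : ball y (2 * ρ) ⊆ B) {m D E a : ℝ≥0∞} (hm : m ≠ 0)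
    (hmt : m ≠ ⊤) (hBmeas : μ B ≤ m) (hDx : m ≤ D * μ (ball x ρ)) (hDy : m ≤ D * μ (ball y ρ))
    (hDt : D ≠ ⊤) (hEt : E ≠ ⊤) (h1 : ∫⁻ z in B, (f z - a) ∂μ ≤ E * m)
    (h2 : ∫⁻ z in B, (a - f z) ∂μ ≤ E * m) :
    smoothAverage μ ρ f x ≤ smoothAverage μ ρ f y +
      ENNReal.ofReal (dist x y / ρ) * (2 * (D + 2 * D ^ 2) * E) := by
  have hp := smoothAverage_le_add hμ hρ (hf.sub_const a) hBm hx hy hm hmt hBmeas hDx hDy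
  have hn := smoothAverage_le_add hμ hρ (hf.const_sub a) hBm hy hx hm hmt hBmeas hDy hDx
  rw [dist_comm y x] at hn
  have hnf : smoothAverage μ ρ (fun z => a - f z) x ≠ ⊤ := by
    refine ((smoothAverage_le hρ (fun z => a - f z) hx hm hmt hDx).trans_lt ?_).ne
    refine ENNReal.mul_lt_top (ENNReal.mul_lt_top (by simp) hDt.lt_top) ?_
    exact (ENNReal.div_le_of_le_mul h2).trans_lt hEt.lt_top
  have h1' := ENNReal.div_le_of_le_mul h1
  have h2' := ENNReal.div_le_of_le_mul h2
  refine (ENNReal.add_le_add_iff_right hnf).1 ?_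
  calc smoothAverage μ ρ f x + smoothAverage μ ρ (fun z => a - f z) x
      = a + smoothAverage μ ρ (fun z => f z - a) x := smoothAverage_add_tsub hμ hρ hf a x
    _ ≤ a + (smoothAverage μ ρ (fun z => f z - a) y +
        ENNReal.ofReal (dist x y / ρ) * (D + 2 * D ^ 2) * E) := by
        gcongr
        exact hp.trans (by gcongr)
    _ = smoothAverage μ ρ f y + smoothAverage μ ρ (fun z => a - f z) y +
        ENNReal.ofReal (dist x y / ρ) * (D + 2 * D ^ 2) * E := by
        rw [smoothAverage_add_tsub hμ hρ hf a y, add_assoc]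
    _ ≤ smoothAverage μ ρ f y + (smoothAverage μ ρ (fun z => a - f z) x +
        ENNReal.ofReal (dist x y / ρ) * (D + 2 * D ^ 2) * E) +
        ENNReal.ofReal (dist x y / ρ) * (D + 2 * D ^ 2) * E := by
        gcongr
        exact hn.trans (by gcongr)
    _ = _ := by ring

/-- The numerators and denominators of smooth averages are lower semicontinuous in the centre, by
Fatou's lemma. -/
theorem measurable_lintegral_averagingKernel_mul {f : P → ℝ≥0∞} (hf : AEMeasurable f μ) :
    Measurable fun x => ∫⁻ z, averagingKernel ρ x z * f z ∂μ := by
  refine LowerSemicontinuous.measurable ?_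
  rw [lowerSemicontinuous_iff_le_liminf]
  intro x
  refine le_trans (lintegral_mono fun z => ?_) (lintegral_liminf_le' (u := 𝓝 x)
    (f := fun y z => averagingKernel ρ y z * f z)
    (fun y => aemeasurable_averagingKernel_mul hf y))
  rcases eq_or_ne (averagingKernel ρ x z) 0 with h0 | h0
  · simp [h0]
  · exact (ENNReal.Tendsto.mul_const ((continuous_averagingKernel_left z).tendsto x)
      (Or.inl h0)).liminf_eq.ge

theorem measurable_smoothAverage {f : P → ℝ≥0∞} (hf : AEMeasurable f μ) :
    Measurable (smoothAverage μ ρ f) := by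
  refine (measurable_lintegral_averagingKernel_mul hf).div ?_
  simpa using measurable_lintegral_averagingKernel_mul (μ := μ) (ρ := ρ) (f := fun _ => 1)
    aemeasurable_const


/-- The smooth averages of `f` inherit a gradient from `f`. For `d(x,y) ≤ ρ` this is the
Sobolev–Poincaré inequality on the ball `B(x,4ρ)`; for `d(x,y) > ρ` both averages are compared with
the values of `f`. -/
theorem exists_smoothAverage_gradient (hμ : BallsPosFinite μ) {Q s : ℝ} (hQ : 0 < Q)
    (hμQ : LowerMassBound μ Q) (hs : 0 < s) (hs1 : s ≤ 1) :
    ∃ C : ℝ, 0 < C ∧ ∀ (f h : P → ℝ≥0∞) (N : Set P), AEMeasurable f μ → μ N = 0 →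
      (∀ x ∉ N, h x ≠ ⊤) → (∀ x ∉ N, f x ≠ ⊤) →
      (∀ x ∉ N, ∀ y ∉ N, f x ≤ f y + edist x y ^ s * (h x + h y)) →
      ∀ (ρ T : ℝ), 0 < ρ → 0 < T → ∀ x ∉ N, ∀ y ∉ N, h x ≤ ENNReal.ofReal T →
      h y ≤ ENNReal.ofReal T →
      ∫⁻ z in ball x (8 * ρ), h z ^ (Q / (Q + s)) ∂μ ≤
        ENNReal.ofReal (T ^ (Q / (Q + s))) * μ (ball x (8 * ρ)) →
      ∫⁻ z in ball y (8 * ρ), h z ^ (Q / (Q + s)) ∂μ ≤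
        ENNReal.ofReal (T ^ (Q / (Q + s))) * μ (ball y (8 * ρ)) →
      smoothAverage μ ρ f x ≤ smoothAverage μ ρ f y + ENNReal.ofReal (C * T) * edist x y ^ s ∧
        smoothAverage μ ρ f x ≤ f x + ENNReal.ofReal (C * ρ ^ s * T) := by
  obtain ⟨c, hc, hmass⟩ := hμQ.exists_mul_le hμ
  obtain ⟨C₀, hC₀, HP⟩ := exists_sobolev_poincare hμ hQ hμQ hs
  -- `D` is the doubling constant from radius `8ρ` to radius `ρ`
  set D : ℝ := (c * (1 / 8) ^ Q)⁻¹ with hD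
  have hD0 : 0 < D := by positivity
  set C₁ : ℝ := C₀ * 4 ^ s with hC₁
  have hC₁0 : 0 < C₁ := by positivity
  set C₂ : ℝ := 2 * D * C₁ + C₁ with hC₂
  have hC₂0 : 0 < C₂ := by positivity
  refine ⟨2 * C₂ + 2 + 2 * (D + 2 * D ^ 2) * C₁, by positivity, ?_⟩
  intro f h N hf hN hhN hfN hgrad ρ T hρ hT
  have hdouble : ∀ x y : P, y ∈ ball x (8 * ρ) →
      μ (ball x (8 * ρ)) ≤ ENNReal.ofReal D * μ (ball y ρ) := by
    intro x y hy
    have h1 := hmass x y ρ (8 * ρ) hρ (by linarith) hy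
    have h2 : c * (ρ / (8 * ρ)) ^ Q = D⁻¹ := by
      rw [hD, inv_inv, show ρ / (8 * ρ) = 1 / 8 by field_simp]
    rw [h2, ENNReal.ofReal_inv_of_pos hD0] at h1
    rwa [ENNReal.inv_mul_le_iff (by simpa using hD0) ENNReal.ofReal_ne_top] at h1
  have hpoinc : ∀ x ∉ N, h x ≤ ENNReal.ofReal T →
      ∫⁻ z in ball x (8 * ρ), h z ^ (Q / (Q + s)) ∂μ ≤
        ENNReal.ofReal (T ^ (Q / (Q + s))) * μ (ball x (8 * ρ)) →
      ∃ a : ℝ≥0∞, a ≠ ⊤ ∧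
        ∫⁻ z in ball x (4 * ρ), (f z - a) ∂μ ≤
          ENNReal.ofReal (C₁ * ρ ^ s * T) * μ (ball x (8 * ρ)) ∧
        ∫⁻ z in ball x (4 * ρ), (a - f z) ∂μ ≤
          ENNReal.ofReal (C₁ * ρ ^ s * T) * μ (ball x (8 * ρ)) ∧
        f x ≤ a + ENNReal.ofReal (C₁ * ρ ^ s * T) ∧ a ≤ f x + ENNReal.ofReal (C₁ * ρ ^ s * T) := by
    intro x hx hhx hint
    rw [show 8 * ρ = 2 * (4 * ρ) by ring] at hint ⊢
    obtain ⟨a, ha, h1, h2, h3⟩ := HP f h N hN hhN hfN hgrad x (4 * ρ) T (by positivity) hT hint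
    have e : C₀ * (4 * ρ) ^ s * T = C₁ * ρ ^ s * T := by
      rw [Real.mul_rpow (by norm_num) hρ.le]; ring
    rw [e] at h1 h2 h3
    exact ⟨a, ha, h1, h2, h3 x (mem_ball_self (by positivity)) hx hhx⟩
  -- comparison of an average with the value at the centre
  have hpoint : ∀ x ∉ N, h x ≤ ENNReal.ofReal T →
      ∫⁻ z in ball x (8 * ρ), h z ^ (Q / (Q + s)) ∂μ ≤
        ENNReal.ofReal (T ^ (Q / (Q + s))) * μ (ball x (8 * ρ)) →
      smoothAverage μ ρ f x ≤ f x + ENNReal.ofReal (C₂ * ρ ^ s * T) ∧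
      f x ≤ smoothAverage μ ρ f x + ENNReal.ofReal (C₂ * ρ ^ s * T) := by
    intro x hx hhx hint
    obtain ⟨a, ha, h1, h2, h3, h4⟩ := hpoinc x hx hhx hint
    have hm := hμ x (8 * ρ) (by positivity)
    have hsub : ball x (2 * ρ) ⊆ ball x (4 * ρ) := ball_subset_ball (by linarith)
    have hDx := hdouble x x (mem_ball_self (by positivity))
    have hE : 2 * ENNReal.ofReal D * ENNReal.ofReal (C₁ * ρ ^ s * T) +
        ENNReal.ofReal (C₁ * ρ ^ s * T) = ENNReal.ofReal (C₂ * ρ ^ s * T) := by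
      rw [show (2 : ℝ≥0∞) = ENNReal.ofReal 2 by simp, ← ENNReal.ofReal_mul two_pos.le,
        ← ENNReal.ofReal_mul (by positivity), ← ENNReal.ofReal_add (by positivity) (by positivity)]
      congr 1; rw [hC₂]; ring
    have hp : smoothAverage μ ρ (fun z => f z - a) x ≤
        2 * ENNReal.ofReal D * ENNReal.ofReal (C₁ * ρ ^ s * T) :=
      (smoothAverage_le hρ _ hsub hm.1.ne' hm.2.ne hDx).trans
        (by gcongr; exact ENNReal.div_le_of_le_mul h1)
    have hn : smoothAverage μ ρ (fun z => a - f z) x ≤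
        2 * ENNReal.ofReal D * ENNReal.ofReal (C₁ * ρ ^ s * T) :=
      (smoothAverage_le hρ _ hsub hm.1.ne' hm.2.ne hDx).trans
        (by gcongr; exact ENNReal.div_le_of_le_mul h2)
    have hsplit := smoothAverage_add_tsub hμ hρ hf a x
    rw [← hE]
    constructor
    · calc smoothAverage μ ρ f x ≤ a + smoothAverage μ ρ (fun z => f z - a) x :=
            le_self_add.trans hsplit.le
        _ ≤ f x + ENNReal.ofReal (C₁ * ρ ^ s * T) +
            2 * ENNReal.ofReal D * ENNReal.ofReal (C₁ * ρ ^ s * T) := by gcongr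
        _ = _ := by ring
    · calc f x ≤ a + ENNReal.ofReal (C₁ * ρ ^ s * T) := h3
        _ ≤ smoothAverage μ ρ f x + smoothAverage μ ρ (fun z => a - f z) x +
            ENNReal.ofReal (C₁ * ρ ^ s * T) := by
            gcongr
            exact le_self_add.trans hsplit.ge
        _ ≤ _ := by rw [add_assoc]; gcongr
  intro x hx y hy hhx hhy hintx hinty
  obtain ⟨hx1, hx2⟩ := hpoint x hx hhx hintx
  obtain ⟨hy1, hy2⟩ := hpoint y hy hhy hinty
  have hρs : 0 < ρ ^ s := by positivity
  have hDC : 0 < 2 * (D + 2 * D ^ 2) * C₁ := by positivity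
  refine ⟨?_, hx1.trans ?_⟩
  swap
  · gcongr; linarith
  rw [edist_rpow_eq hs, ← ENNReal.ofReal_mul (by positivity)]
  rcases le_or_gt (dist x y) ρ with hd | hd
  · obtain ⟨a, ha, h1, h2, -, -⟩ := hpoinc x hx hhx hintx
    have hm := hμ x (8 * ρ) (by positivity)
    have hyx : y ∈ ball x (8 * ρ) := by
      rw [mem_ball, dist_comm]; linarith
    have key := smoothAverage_le_add_of_deviation hμ hρ hf (x := x) (y := y) measurableSet_ball
      (B := ball x (4 * ρ)) (ball_subset_ball (by linarith))
      (ball_subset_ball' (by rw [dist_comm]; linarith)) hm.1.ne' hm.2.ne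
      (measure_mono (ball_subset_ball (by linarith))) (hdouble x x (mem_ball_self (by positivity)))
      (hdouble x y hyx) ENNReal.ofReal_ne_top ENNReal.ofReal_ne_top h1 h2
    refine key.trans ?_
    gcongr
    rw [show (2 : ℝ≥0∞) = ENNReal.ofReal 2 by simp, ← ENNReal.ofReal_pow hD0.le,
      ← ENNReal.ofReal_mul two_pos.le, ← ENNReal.ofReal_add (by positivity) (by positivity),
      ← ENNReal.ofReal_mul two_pos.le, ← ENNReal.ofReal_mul (by positivity),
      ← ENNReal.ofReal_mul (by positivity)]
    refine ENNReal.ofReal_le_ofReal ?_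
    -- `d ≤ ρ` and `s ≤ 1` give `(d / ρ) ρ ^ s ≤ d ^ s`
    have h3 : dist x y / ρ * ρ ^ s ≤ dist x y ^ s := by
      have h4 : dist x y / ρ ≤ (dist x y / ρ) ^ s := by
        rcases (div_nonneg dist_nonneg hρ.le : 0 ≤ dist x y / ρ).eq_or_lt with h0 | h0
        · rw [← h0, Real.zero_rpow hs.ne']
        · simpa using Real.rpow_le_rpow_of_exponent_ge h0 ((div_le_one hρ).2 hd) hs1
      calc dist x y / ρ * ρ ^ s ≤ (dist x y / ρ) ^ s * ρ ^ s := by gcongr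
        _ = dist x y ^ s := by
          rw [← Real.mul_rpow (by positivity) hρ.le, div_mul_cancel₀ _ hρ.ne']
    calc dist x y / ρ * (2 * (D + 2 * D ^ 2) * (C₁ * ρ ^ s * T))
        = 2 * (D + 2 * D ^ 2) * C₁ * T * (dist x y / ρ * ρ ^ s) := by ring
      _ ≤ (2 * C₂ + 2 + 2 * (D + 2 * D ^ 2) * C₁) * T * dist x y ^ s := by
        gcongr; linarith
  · have hds : ρ ^ s ≤ dist x y ^ s := by gcongr
    have e := edist_rpow_mul_le hs (le_refl (dist x y)) hT.le hT.le hhx hhy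
    have hC2 : C₂ * ρ ^ s * T ≤ C₂ * dist x y ^ s * T := by gcongr
    calc smoothAverage μ ρ f x ≤ f x + ENNReal.ofReal (C₂ * ρ ^ s * T) := hx1
      _ ≤ f y + ENNReal.ofReal (dist x y ^ s * (T + T)) + ENNReal.ofReal (C₂ * ρ ^ s * T) := by
        gcongr
        exact (hgrad x hx y hy).trans (by gcongr)
      _ ≤ smoothAverage μ ρ f y + ENNReal.ofReal (C₂ * ρ ^ s * T) +
          ENNReal.ofReal (dist x y ^ s * (T + T)) + ENNReal.ofReal (C₂ * ρ ^ s * T) := by gcongr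
      _ ≤ _ := by
        rw [add_assoc, add_assoc, ← ENNReal.ofReal_add (by positivity) (by positivity),
          ← ENNReal.ofReal_add (by positivity) (by positivity)]
        gcongr
        have : 0 ≤ 2 * (D + 2 * D ^ 2) * C₁ * T * dist x y ^ s := by positivity
        nlinarith

/-- The maximal function of `f` formed with smooth averages of rational radius less than `1/8`.
Rational radii suffice, and make measurability immediate. -/
noncomputable def smoothMaximal (μ : Measure P) (f : P → ℝ≥0∞) (x : P) : ℝ≥0∞ :=
  ⨆ ρ : {ρ : ℚ // 0 < ρ ∧ 8 * ρ < 1}, smoothAverage μ (ρ : ℚ) f x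

theorem measurable_smoothMaximal {f : P → ℝ≥0∞} (hf : AEMeasurable f μ) :
    Measurable (smoothMaximal μ f) :=
  Measurable.iSup fun _ => measurable_smoothAverage hf

/-- The smooth maximal function dominates the averages over small balls, uniformly on the ball over
which the average is taken. -/
theorem exists_laverage_le_smoothMaximal (hμ : BallsPosFinite μ) {Q : ℝ}
    (hμQ : LowerMassBound μ Q) :
    ∃ C : ℝ, 0 < C ∧ ∀ (f : P → ℝ≥0∞) (x : P) (r : ℝ), 0 < r → r ≤ 1 / 32 → ∀ y ∈ ball x r,
      ⨍⁻ z in ball x r, f z ∂μ ≤ ENNReal.ofReal C * smoothMaximal μ f y := by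
  obtain ⟨c, hc, hmass⟩ := hμQ.exists_mul_le hμ
  set D : ℝ := (c * (1 / 16) ^ Q)⁻¹ with hD
  have hD0 : 0 < D := by positivity
  refine ⟨2 * D, by positivity, ?_⟩
  intro f x r hr hr1 y hy
  obtain ⟨ρ, hρ1, hρ2⟩ := exists_rat_btwn (show 2 * r < 4 * r by linarith)
  have hρ : 0 < (ρ : ℝ) := by linarith
  have hρm : 0 < ρ ∧ 8 * ρ < 1 := by
    refine ⟨by exact_mod_cast hρ, ?_⟩
    have : (8 * ρ : ℝ) < 1 := by linarith
    exact_mod_cast this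
  have hle : smoothAverage μ ρ f y ≤ smoothMaximal μ f y :=
    le_iSup (fun ρ : {ρ : ℚ // 0 < ρ ∧ 8 * ρ < 1} => smoothAverage μ (ρ : ℚ) f y) ⟨ρ, hρm⟩
  have hyd := mem_ball.1 hy
  rw [setLAverage_eq]
  refine ENNReal.div_le_of_le_mul ?_
  calc ∫⁻ z in ball x r, f z ∂μ ≤ ∫⁻ z in ball y ρ, f z ∂μ :=
        lintegral_mono_set (ball_subset_ball' (by rw [dist_comm]; linarith))
    _ ≤ ∫⁻ z, averagingKernel ρ y z * f z ∂μ := setLIntegral_le_lintegral_averagingKernel_mul hρ y f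
    _ = smoothAverage μ ρ f y * ∫⁻ z, averagingKernel ρ y z ∂μ := by
        rw [smoothAverage, ENNReal.div_mul_cancel
          (lintegral_averagingKernel_ne_zero hμ hρ y) (lintegral_averagingKernel_ne_top hμ hρ y)]
    _ ≤ smoothMaximal μ f y * (2 * (ENNReal.ofReal D * μ (ball x r))) := by
        gcongr
        refine (lintegral_averagingKernel_le hρ y).trans ?_
        gcongr
        refine (measure_mono (ball_subset_ball' (ε₂ := 16 * r) (y := x) (by linarith))).trans ?_
        have h1 := hmass x x r (16 * r) hr (by linarith) (mem_ball_self (by positivity))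
        have h2 : c * (r / (16 * r)) ^ Q = D⁻¹ := by
          rw [hD, inv_inv, show r / (16 * r) = 1 / 16 by field_simp]
        rw [h2, ENNReal.ofReal_inv_of_pos hD0] at h1
        rwa [ENNReal.inv_mul_le_iff (by simpa using hD0) ENNReal.ofReal_ne_top] at h1
    _ = _ := by
        rw [ENNReal.ofReal_mul two_pos.le]
        simp only [ENNReal.ofReal_ofNat]
        ring

/-- The smooth maximal function of `f` has the gradient `h + (M₁ h^q)^(1/q)`, up to a constant, and
it exceeds `f` by at most a multiple of this gradient. -/
theorem exists_smoothMaximal_gradient (hμ : BallsPosFinite μ) {Q s : ℝ} (hQ : 0 < Q)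
    (hμQ : LowerMassBound μ Q) (hs : 0 < s) (hs1 : s ≤ 1) :
    ∃ C : ℝ≥0, ∀ (f h : P → ℝ≥0∞) (N : Set P), AEMeasurable f μ → μ N = 0 →
      (∀ x ∉ N, h x ≠ ⊤) → (∀ x ∉ N, f x ≠ ⊤) →
      (∀ x ∉ N, ∀ y ∉ N, f x ≤ f y + edist x y ^ s * (h x + h y)) →
      ∀ k : P → ℝ≥0∞, (∀ x, k x = h x + restrictedMaximal μ 1 (fun z => h z ^ (Q / (Q + s))) x ^
        (1 / (Q / (Q + s)))) →
      ∀ x ∉ N, ∀ y ∉ N, k x ≠ ⊤ → k y ≠ ⊤ →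
        smoothMaximal μ f x ≤ smoothMaximal μ f y + edist x y ^ s * (C * k x + C * k y) ∧
        smoothMaximal μ f x ≤ f x + C * (k x + k y) := by
  obtain ⟨C, hC, H⟩ := exists_smoothAverage_gradient hμ hQ hμQ hs hs1
  set q := Q / (Q + s) with hqdef
  have hq : 0 < q := by positivity
  refine ⟨C.toNNReal, ?_⟩
  intro f h N hf hN hhN hfN hgrad k hk x hx y hy hkx hky
  change smoothMaximal μ f x ≤ smoothMaximal μ f y +
      edist x y ^ s * (ENNReal.ofReal C * k x + ENNReal.ofReal C * k y) ∧
    smoothMaximal μ f x ≤ f x + ENNReal.ofReal C * (k x + k y)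
  have hint : ∀ (ρ T : ℝ), 0 < ρ → 8 * ρ < 1 → 0 < T → ∀ w, k w ≤ ENNReal.ofReal T →
      ∫⁻ z in ball w (8 * ρ), h z ^ q ∂μ ≤ ENNReal.ofReal (T ^ q) * μ (ball w (8 * ρ)) := by
    intro ρ T hρ hρ1 hT w hw
    have hm := hμ w (8 * ρ) (by positivity)
    have h1 : ⨍⁻ z in ball w (8 * ρ), h z ^ q ∂μ ≤ restrictedMaximal μ 1 (fun z => h z ^ q) w :=
      le_iSup_of_le (8 * ρ) (le_iSup_of_le (by positivity) (le_iSup_of_le hρ1 le_rfl))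
    have h2 : restrictedMaximal μ 1 (fun z => h z ^ q) w ≤ ENNReal.ofReal (T ^ q) := by
      rw [← ENNReal.ofReal_rpow_of_pos hT]
      have h3 : restrictedMaximal μ 1 (fun z => h z ^ q) w ^ (1 / q) ≤ ENNReal.ofReal T :=
        (le_add_self.trans (hk w).ge).trans hw
      rw [one_div] at h3
      rw [← ENNReal.rpow_inv_le_iff hq]
      exact h3
    have h4 := h1.trans h2
    rw [setLAverage_eq] at h4
    exact (ENNReal.div_le_iff hm.1.ne' hm.2.ne).1 h4
  -- apply the estimate with `T` slightly above `k x + k y`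
  have key : ∀ ε : ℝ, 0 < ε → ∀ ρ : {ρ : ℚ // 0 < ρ ∧ 8 * ρ < 1},
      smoothAverage μ (ρ : ℚ) f x ≤ smoothAverage μ (ρ : ℚ) f y +
        ENNReal.ofReal C * (k x + k y + ENNReal.ofReal ε) * edist x y ^ s ∧
      smoothAverage μ (ρ : ℚ) f x ≤ f x + ENNReal.ofReal C * (k x + k y + ENNReal.ofReal ε) := by
    rintro ε hε ⟨ρ, hρ0, hρ1⟩
    have hρ0' : (0 : ℝ) < ρ := by exact_mod_cast hρ0
    have hρ1' : (8 * ρ : ℝ) < 1 := by exact_mod_cast hρ1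
    set T : ℝ := (k x + k y).toReal + ε with hT
    have hT0 : 0 < T := add_pos_of_nonneg_of_pos ENNReal.toReal_nonneg hε
    have hTeq : ENNReal.ofReal T = k x + k y + ENNReal.ofReal ε := by
      rw [hT, ENNReal.ofReal_add ENNReal.toReal_nonneg hε.le,
        ENNReal.ofReal_toReal (ENNReal.add_ne_top.2 ⟨hkx, hky⟩)]
    have hxT : k x ≤ ENNReal.ofReal T := by rw [hTeq, add_assoc]; exact le_self_add
    have hyT : k y ≤ ENNReal.ofReal T := by
      rw [hTeq]; exact le_add_self.trans le_self_add
    have hh : ∀ w, h w ≤ k w := fun w => by rw [hk w]; exact le_self_add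
    obtain ⟨h1, h2⟩ := H f h N hf hN hhN hfN hgrad ρ T hρ0' hT0 x hx y hy ((hh x).trans hxT)
      ((hh y).trans hyT) (hint ρ T hρ0' hρ1' hT0 x hxT) (hint ρ T hρ0' hρ1' hT0 y hyT)
    rw [← hTeq, ← ENNReal.ofReal_mul hC.le]
    refine ⟨h1, h2.trans ?_⟩
    gcongr
    have h3 : (ρ : ℝ) ^ s ≤ 1 := Real.rpow_le_one hρ0'.le (by linarith) hs.le
    exact mul_le_of_le_one_right hC.le h3
  have hlim : Tendsto (fun ε : ℝ => k x + k y + ENNReal.ofReal ε) (𝓝[>] 0)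
      (𝓝 (k x + k y)) := by
    have h1 : Tendsto (fun ε : ℝ => ENNReal.ofReal ε) (𝓝[>] 0) (𝓝 (ENNReal.ofReal 0)) :=
      (ENNReal.continuous_ofReal.tendsto 0).mono_left nhdsWithin_le_nhds
    simpa using h1.const_add (k x + k y)
  have hlimC : Tendsto (fun ε : ℝ => ENNReal.ofReal C * (k x + k y + ENNReal.ofReal ε)) (𝓝[>] 0)
      (𝓝 (ENNReal.ofReal C * (k x + k y))) :=
    ENNReal.Tendsto.const_mul hlim (Or.inr ENNReal.ofReal_ne_top)
  have hpos : ∀ᶠ ε : ℝ in 𝓝[>] 0, 0 < ε := eventually_mem_nhdsWithin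
  constructor
  · refine iSup_le fun ρ => ?_
    refine le_trans ?_ (add_le_add (le_iSup (fun ρ : {ρ : ℚ // 0 < ρ ∧ 8 * ρ < 1} =>
      smoothAverage μ (ρ : ℚ) f y) ρ) le_rfl)
    have he : edist x y ^ s ≠ ⊤ := ENNReal.rpow_ne_top_of_nonneg hs.le (edist_ne_top _ _)
    have h1 := (ENNReal.Tendsto.mul_const hlimC (Or.inr he)).const_add
      (smoothAverage μ (ρ : ℚ) f y)
    rw [← mul_add, mul_comm (edist x y ^ s)]
    refine ge_of_tendsto h1 ?_
    filter_upwards [hpos] with ε hε using (key ε hε ρ).1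
  · refine iSup_le fun ρ => ?_
    refine ge_of_tendsto (hlimC.const_add (f x)) ?_
    filter_upwards [hpos] with ε hε using (key ε hε ρ).2

end SmoothAverage

/-! ### Capacitary weak type estimates -/

section WeakType

variable {P : Type*} [MetricSpace P] [MeasurableSpace P] {μ : Measure P}

theorem IsNonnegSGradientOn.mono_ae {s : ℝ} {A : Set P} {v h k : P → ℝ≥0∞}
    (hv : IsNonnegSGradientOn μ s A v h) (hk : ∀ᵐ x ∂μ, h x ≤ k x) :
    IsNonnegSGradientOn μ s A v k := by
  obtain ⟨N, hN, hfin, hgr⟩ := hv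
  refine ⟨N ∪ {x | ¬ h x ≤ k x}, measure_union_null hN hk, ?_, ?_⟩
  · rintro x ⟨hxA, hx⟩
    exact hfin x ⟨hxA, fun h => hx (Or.inl h)⟩
  · rintro x ⟨hxA, hx⟩ y ⟨hyA, hy⟩
    refine (hgr x ⟨hxA, fun h => hx (Or.inl h)⟩ y ⟨hyA, fun h => hy (Or.inl h)⟩).trans ?_
    gcongr
    · exact not_not.1 fun h => hx (Or.inr h)
    · exact not_not.1 fun h => hy (Or.inr h)

theorem IsNonnegSGradientOn.add {s : ℝ} {A : Set P} {v w h k : P → ℝ≥0∞}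
    (hv : IsNonnegSGradientOn μ s A v h) (hw : IsNonnegSGradientOn μ s A w k) :
    IsNonnegSGradientOn μ s A (fun x => v x + w x) (fun x => h x + k x) := by
  obtain ⟨N, hN, hfin, hgr⟩ := hv
  obtain ⟨M, hM, hfin', hgr'⟩ := hw
  refine ⟨N ∪ M, measure_union_null hN hM, ?_, ?_⟩
  · rintro x ⟨hxA, hx⟩
    exact ENNReal.add_ne_top.2 ⟨hfin x ⟨hxA, fun h => hx (Or.inl h)⟩,
      hfin' x ⟨hxA, fun h => hx (Or.inr h)⟩⟩
  · rintro x ⟨hxA, hx⟩ y ⟨hyA, hy⟩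
    calc v x + w x ≤ (v y + edist x y ^ s * (h x + h y)) + (w y + edist x y ^ s * (k x + k y)) :=
          add_le_add (hgr x ⟨hxA, fun h => hx (Or.inl h)⟩ y ⟨hyA, fun h => hy (Or.inl h)⟩)
            (hgr' x ⟨hxA, fun h => hx (Or.inr h)⟩ y ⟨hyA, fun h => hy (Or.inr h)⟩)
      _ = _ := by ring

variable [BorelSpace P] (X : QuasiBanachFunctionSpace μ) {s : ℝ}

/-- If `k` controls both the values of `v` and its gradient on `B(x₀,2R)`, then the localized
function belongs to the Hajłasz space, with norm controlled by `k`. -/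
theorem exists_cutoff_gradient (hs0 : 0 < s) (hs1 : s ≤ 1) (x₀ : P) {R : ℝ} (hR : 0 < R)
    {v k : P → ℝ≥0∞} {b : ℝ≥0} (hv : AEMeasurable v μ)
    (hgr : IsNonnegSGradientOn μ s (ball x₀ (2 * R)) v (fun x => b * k x))
    (hle : ∀ᵐ x ∂μ, x ∈ ball x₀ (2 * R) → v x ≤ b * k x) :
    ∃ g : P → ℝ≥0∞, IsNonnegSGradientOn μ s univ (fun x => cutoff x₀ R x * v x) g ∧
      X.qnormNonneg (fun x => cutoff x₀ R x * v x) + X.qnormNonneg g ≤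
        ((2 + (R ^ (-s)).toNNReal) * b : ℝ≥0) * X.qnormNonneg k := by
  set ℓ : ℝ≥0 := (R ^ (-s)).toNNReal with hℓ
  refine ⟨fun x => ((1 + ℓ) * b : ℝ≥0) * k x, (hgr.cutoff_mul hs0 hs1 hR).mono_ae ?_, ?_⟩
  · filter_upwards [hle] with x hx
    by_cases hxB : x ∈ ball x₀ (2 * R)
    · rw [indicator_of_mem hxB]
      calc b * k x + ENNReal.ofReal (R ^ (-s)) * v x
          ≤ b * k x + ENNReal.ofReal (R ^ (-s)) * (b * k x) := by gcongr; exact hx hxB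
        _ = ((1 + ℓ) * b : ℝ≥0) * k x := by
          rw [ENNReal.ofReal, ← hℓ]; push_cast; ring
    · rw [indicator_of_notMem hxB]; exact zero_le
  · have h1 : X.qnormNonneg (fun x => cutoff x₀ R x * v x) ≤ b * X.qnormNonneg k := by
      refine (X.qnormNonneg_mono_ae (continuous_cutoff.measurable.aemeasurable.mul hv)
        (g := fun x => b * k x) ?_).trans (X.qnormNonneg_const_mul b k)
      filter_upwards [hle] with x hx
      by_cases hxB : x ∈ ball x₀ (2 * R)
      · exact (mul_le_of_le_one_left zero_le (cutoff_le_one x)).trans (hx hxB)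
      · simp [cutoff_eq_zero hR hxB]
    refine (add_le_add h1 (X.qnormNonneg_const_mul _ k)).trans (le_of_eq ?_)
    push_cast; ring

/-- Capacitary estimate for the superlevel sets of a quasicontinuous function. -/
theorem exists_capacity_superlevel_le (hs0 : 0 < s) (hs1 : s ≤ 1) (x₀ : P) {R : ℝ} (hR : 0 < R)
    (A : ℝ≥0) :
    ∃ C : ℝ≥0, ∀ w h : P → ℝ≥0∞, AEMeasurable w μ → IsNonnegSGradientOn μ s univ w h →
      (∀ᵐ x ∂μ, x ∈ ball x₀ (2 * R) → w x ≤ A * h x) → ∀ τ : ℝ≥0,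
      (∀ ε : ℝ≥0∞, 0 < ε → ∃ E O : Set P, capacity X s E < ε ∧ IsOpen O ∧
        {x | 1 < τ * w x} ∩ Eᶜ = O ∩ Eᶜ) →
      capacity X s {x ∈ ball x₀ R | 1 < τ * w x} ≤ C * τ * X.qnormNonneg h := by
  obtain ⟨K, hK1, hK⟩ := X.exists_qnormNonneg_add_le
  refine ⟨K * ((2 + (R ^ (-s)).toNNReal) * (1 + A)), fun w h hw hwh hA τ hqc => ?_⟩
  have hgr : IsNonnegSGradientOn μ s (ball x₀ (2 * R)) (fun x => τ * w x)
      (fun x => ((τ * (1 + A) : ℝ≥0) : ℝ≥0∞) * h x) := by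
    obtain ⟨N, hN, hfin, hg⟩ := hwh
    refine ⟨N, hN, fun x hx => ENNReal.mul_ne_top ENNReal.coe_ne_top (hfin x ⟨mem_univ _, hx.2⟩),
      fun x hx y hy => ?_⟩
    calc τ * w x ≤ τ * (w y + edist x y ^ s * (h x + h y)) := by
          gcongr; exact hg x ⟨mem_univ _, hx.2⟩ y ⟨mem_univ _, hy.2⟩
      _ = τ * w y + edist x y ^ s * ((τ * 1 : ℝ≥0) * h x + (τ * 1 : ℝ≥0) * h y) := by
          push_cast; ring
      _ ≤ _ := by
          beta_reduce
          gcongr <;> exact le_self_add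
  obtain ⟨g, hg, hgle⟩ := exists_cutoff_gradient X hs0 hs1 x₀ hR (hw.const_mul τ) hgr (by
    filter_upwards [hA] with x hx hxB
    calc τ * w x ≤ τ * (A * h x) := by gcongr; exact hx hxB
      _ = (τ * A : ℝ≥0) * h x := by push_cast; ring
      _ ≤ _ := by gcongr; exact le_add_self)
  set M := X.qnormNonneg h with hM
  have key : ∀ ε : ℝ≥0, 0 < ε → capacity X s {x ∈ ball x₀ R | 1 < τ * w x} ≤
      K * (((2 + (R ^ (-s)).toNNReal) * (τ * (1 + A)) : ℝ≥0) * M + ε) := by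
    intro ε hε
    obtain ⟨E, O, hE, hO, hEO⟩ := hqc ε (by exact_mod_cast hε)
    obtain ⟨v, k, hvk, hlt, U, hU, hEU, hv1⟩ := exists_of_capacity_lt hE
    refine (capacity_le (X := X) (hg.add hvk) ((hO.inter isOpen_ball).union hU)
      (U := (O ∩ ball x₀ R) ∪ U) ?_ ?_).trans ?_
    · rintro x ⟨hxB, hx⟩
      by_cases hxE : x ∈ E
      · exact Or.inr (hEU hxE)
      · have : x ∈ O ∩ Eᶜ := hEO ▸ ⟨hx, hxE⟩
        exact Or.inl ⟨this.1, hxB⟩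
    · intro x hx
      by_cases hxU : x ∈ U
      · exact (hv1 x hxU).trans le_add_self
      · obtain ⟨hxO, hxB⟩ := hx.resolve_right hxU
        have : x ∈ {x | 1 < τ * w x} ∩ Eᶜ := hEO ▸ ⟨hxO, fun h => hxU (hEU h)⟩
        refine le_trans ?_ le_self_add
        rw [cutoff_eq_one hR hxB, one_mul]
        exact (show 1 < τ * w x from this.1).le
    · refine (add_le_add (hK _ _) (hK _ _)).trans ?_
      rw [← mul_add, add_add_add_comm]
      exact mul_le_mul_right (add_le_add hgle hlt.le) _
  have hlim : Tendsto (fun ε : ℝ≥0 => (K : ℝ≥0∞) *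
      (((2 + (R ^ (-s)).toNNReal) * (τ * (1 + A)) : ℝ≥0) * M + ε)) (𝓝[>] 0)
      (𝓝 (K * (((2 + (R ^ (-s)).toNNReal) * (τ * (1 + A)) : ℝ≥0) * M + (0 : ℝ≥0)))) := by
    refine ENNReal.Tendsto.const_mul (Tendsto.const_add _ ?_) (Or.inr ENNReal.coe_ne_top)
    exact (ENNReal.continuous_coe.tendsto 0).mono_left nhdsWithin_le_nhds
  refine (ge_of_tendsto hlim ?_).trans (le_of_eq ?_)
  · filter_upwards [eventually_mem_nhdsWithin] with ε hε using key ε hε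
  · push_cast; ring

/-- Capacitary estimate for the set where some average of `w` over a small ball is large. -/
theorem exists_capacity_maximal_le (hμ : BallsPosFinite μ) {Q : ℝ} (hQ : 0 < Q)
    (hμQ : LowerMassBound μ Q) (hs0 : 0 < s) (hs1 : s ≤ 1)
    (hM : MaximalLocallyBounded X (Q / (Q + s))) (x₀ : P) {R : ℝ} (hR : 0 < R) (A : ℝ≥0) :
    ∃ C : ℝ≥0, ∀ w h : P → ℝ≥0∞, AEMeasurable w μ → IsNonnegSGradientOn μ s univ w h →
      X.qnormNonneg h < ∞ →
      (∀ᵐ x ∂μ, x ∈ ball x₀ (2 * R) → w x ≤ A * h x) → ∀ τ : ℝ≥0,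
      capacity X s {x ∈ ball x₀ R | ∃ r : ℝ, 0 < r ∧ r ≤ 1 / 32 ∧
        1 < τ * ⨍⁻ z in ball x r, w z ∂μ} ≤ C * τ * X.qnormNonneg h := by
  obtain ⟨K, hK1, hK⟩ := X.exists_qnormNonneg_add_le
  obtain ⟨CM, hCM⟩ := hM x₀ (2 * R) (by positivity)
  obtain ⟨C₁, hC₁, hlow⟩ := exists_laverage_le_smoothMaximal hμ hμQ
  obtain ⟨C₂, hgrad⟩ := exists_smoothMaximal_gradient hμ hQ hμQ hs0 hs1
  set c₁ : ℝ≥0 := C₁.toNNReal with hc₁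
  set b : ℝ≥0 := c₁ * (A + 2 * C₂) with hb
  refine ⟨(2 + (R ^ (-s)).toNNReal) * b * K * (1 + CM), fun w h hw hwh hh hA τ => ?_⟩
  obtain ⟨N₀, hN₀, hfin, hgr⟩ := hwh
  set q := Q / (Q + s) with hq
  set G : P → ℝ≥0∞ := fun x => restrictedMaximal μ 1 (fun y => h y ^ q) x ^ (1 / q) with hG
  set B := ball x₀ (2 * R) with hB
  have hGN : X.qnormNonneg (B.indicator G) ≤ CM * X.qnormNonneg h := hCM h hh
  have hGfin : X.qnormNonneg (B.indicator G) < ∞ :=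
    hGN.trans_lt (ENNReal.mul_lt_top ENNReal.coe_lt_top hh)
  set N := N₀ ∪ {x | ¬ h x ≠ ⊤} with hNdef
  have hN : μ N = 0 := measure_union_null hN₀ (X.ae_ne_top_of_qnormNonneg_lt_top hh)
  have hN' : ∀ x ∉ N, x ∈ univ \ N₀ := fun x hx => ⟨mem_univ _, fun h => hx (Or.inl h)⟩
  have hhN : ∀ x ∉ N, h x ≠ ⊤ := fun x hx => not_not.1 fun h => hx (Or.inr h)
  have hmain := hgrad w h N hw hN hhN (fun x hx => hfin x (hN' x hx))
    (fun x hx y hy => hgr x (hN' x hx) y (hN' y hy)) (fun x => h x + G x) (fun x => rfl)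
  -- on `B` the controlling function is `h + G`
  set k : P → ℝ≥0∞ := fun x => h x + B.indicator G x with hk
  have hkB : ∀ x ∈ B, k x = h x + G x := fun x hx => by simp only [hk, indicator_of_mem hx]
  have hkae : ∀ᵐ x ∂μ, k x ≠ ⊤ := by
    filter_upwards [X.ae_ne_top_of_qnormNonneg_lt_top hh,
      X.ae_ne_top_of_qnormNonneg_lt_top hGfin] with x h1 h2
    exact ENNReal.add_ne_top.2 ⟨h1, h2⟩
  have hkN : X.qnormNonneg k ≤ (K * (1 + CM) : ℝ≥0) * X.qnormNonneg h := by
    refine (hK _ _).trans ?_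
    calc K * (X.qnormNonneg h + X.qnormNonneg (B.indicator G))
        ≤ K * (X.qnormNonneg h + CM * X.qnormNonneg h) := by gcongr
      _ = _ := by push_cast; ring
  set M : Set P := N ∪ {x | ¬ k x ≠ ⊤} ∪ {x | ¬ (x ∈ B → w x ≤ A * h x)} with hMdef
  have hM0 : μ M = 0 := measure_union_null (measure_union_null hN hkae) hA
  have hMN : ∀ x ∉ M, x ∉ N := fun x hx h => hx (Or.inl (Or.inl h))
  have hMk : ∀ x ∉ M, k x ≠ ⊤ := fun x hx => not_not.1 fun h => hx (Or.inl (Or.inr h))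
  have hMA : ∀ x ∉ M, x ∈ B → w x ≤ A * h x := fun x hx => not_not.1 fun h => hx (Or.inr h)
  have hHle : ∀ x ∈ B, x ∉ M → smoothMaximal μ w x ≤ (A + 2 * C₂ : ℝ≥0) * k x := by
    intro x hxB hx
    have hkx := hMk x hx
    rw [hkB x hxB] at hkx ⊢
    calc smoothMaximal μ w x ≤ w x + C₂ * (h x + G x + (h x + G x)) :=
          (hmain x (hMN x hx) x (hMN x hx) hkx hkx).2
      _ ≤ A * (h x + G x) + C₂ * (h x + G x + (h x + G x)) := by
          gcongr
          refine (hMA x hx hxB).trans ?_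
          gcongr
          exact le_self_add
      _ = _ := by push_cast; ring
  have hgrH : IsNonnegSGradientOn μ s B (fun x => (τ * c₁ : ℝ≥0) * smoothMaximal μ w x)
      (fun x => ((τ * b : ℝ≥0) : ℝ≥0∞) * k x) := by
    refine ⟨M, hM0, fun x hx => ?_, fun x hx y hy => ?_⟩
    · refine ENNReal.mul_ne_top ENNReal.coe_ne_top ((hHle x hx.1 hx.2).trans_lt ?_).ne
      exact ENNReal.mul_lt_top ENNReal.coe_lt_top (hMk x hx.2).lt_top
    · have hkx := hMk x hx.2
      have hky := hMk y hy.2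
      rw [hkB x hx.1] at hkx
      rw [hkB y hy.1] at hky
      have h1 := (hmain x (hMN x hx.2) y (hMN y hy.2) hkx hky).1
      rw [← hkB x hx.1, ← hkB y hy.1] at h1
      calc (τ * c₁ : ℝ≥0) * smoothMaximal μ w x
          ≤ (τ * c₁ : ℝ≥0) * (smoothMaximal μ w y + edist x y ^ s * (C₂ * k x + C₂ * k y)) := by
            gcongr
        _ = (τ * c₁ : ℝ≥0) * smoothMaximal μ w y +
            edist x y ^ s * ((τ * (c₁ * C₂) : ℝ≥0) * k x + (τ * (c₁ * C₂) : ℝ≥0) * k y) := by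
            push_cast; ring
        _ ≤ _ := by
            have : c₁ * C₂ ≤ b := by
              rw [hb, two_mul, ← add_assoc]
              exact mul_le_mul_right le_add_self _
            beta_reduce
            gcongr
  obtain ⟨g, hg, hgle⟩ := exists_cutoff_gradient X hs0 hs1 x₀ hR
    ((measurable_smoothMaximal hw).aemeasurable.const_mul _) hgrH (by
      filter_upwards [measure_eq_zero_iff_ae_notMem.1 hM0] with x hx hxB
      calc (τ * c₁ : ℝ≥0) * smoothMaximal μ w x
          ≤ (τ * c₁ : ℝ≥0) * ((A + 2 * C₂ : ℝ≥0) * k x) := by gcongr; exact hHle x hxB hx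
        _ = _ := by rw [hb]; push_cast; ring)
  set U : Set P := (⋃ x : P, ⋃ r : {r : ℝ // 0 < r ∧ r ≤ 1 / 32 ∧
    1 < τ * ⨍⁻ z in ball x r, w z ∂μ}, ball x (r : ℝ)) ∩ ball x₀ R with hU
  have hUo : IsOpen U :=
    (isOpen_iUnion fun x => isOpen_iUnion fun r => isOpen_ball).inter isOpen_ball
  refine (capacity_le (X := X) hg hUo ?_ ?_).trans (hgle.trans ?_)
  · rintro x ⟨hxB, r, hr⟩
    exact ⟨mem_iUnion.2 ⟨x, mem_iUnion.2 ⟨⟨r, hr⟩, mem_ball_self hr.1⟩⟩, hxB⟩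
  · rintro y ⟨hy, hyB⟩
    obtain ⟨x, hy⟩ := mem_iUnion.1 hy
    obtain ⟨⟨r, hr0, hr1, hr2⟩, hy⟩ := mem_iUnion.1 hy
    rw [cutoff_eq_one hR hyB, one_mul]
    refine hr2.le.trans ?_
    calc τ * ⨍⁻ z in ball x r, w z ∂μ ≤ τ * (ENNReal.ofReal C₁ * smoothMaximal μ w y) := by
          gcongr; exact hlow w x r hr0 hr1 y hy
      _ = _ := by rw [ENNReal.ofReal, ← hc₁]; push_cast; ring
  · calc _ ≤ ((2 + (R ^ (-s)).toNNReal) * (τ * b) : ℝ≥0) *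
          ((K * (1 + CM) : ℝ≥0) * X.qnormNonneg h) := by gcongr
      _ = _ := by push_cast; ring

end WeakType

/-! ### Hölder truncation -/

section Truncation

variable {P : Type*} [MetricSpace P]

/-- McShane extension of Hölder functions. -/
theorem exists_holder_extension {s : ℝ} (hs0 : 0 < s) (hs1 : s ≤ 1) {L : ℝ} (hL : 0 ≤ L)
    {F : Set P} (hF : F.Nonempty) {v : P → ℝ}
    (hv : ∀ x ∈ F, ∀ y ∈ F, v x ≤ v y + L * dist x y ^ s) :
    ∃ V : P → ℝ, (∀ x ∈ F, V x = v x) ∧ ∀ x y, V x ≤ V y + L * dist x y ^ s := by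
  have htri : ∀ x y z : P, dist x z ^ s ≤ dist x y ^ s + dist y z ^ s := fun x y z =>
    (Real.rpow_le_rpow dist_nonneg (dist_triangle x y z) hs0.le).trans
      (Real.rpow_add_le_add_rpow dist_nonneg dist_nonneg hs0.le hs1)
  have : Nonempty F := hF.to_subtype
  have hbdd : ∀ x : P, BddBelow (range fun y : F => v y + L * dist x y ^ s) := by
    obtain ⟨y₀, hy₀⟩ := hF
    refine fun x => ⟨v y₀ - L * dist x y₀ ^ s, ?_⟩
    rintro _ ⟨⟨y, hy⟩, rfl⟩
    have h1 := hv y₀ hy₀ y hy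
    have h2 := mul_le_mul_of_nonneg_left (htri y₀ x y) hL
    rw [dist_comm y₀ x] at h2
    dsimp only
    linarith
  refine ⟨fun x => ⨅ y : F, (v y + L * dist x y ^ s), fun x hx => le_antisymm ?_ ?_, fun x y => ?_⟩
  · refine (ciInf_le (hbdd x) ⟨x, hx⟩).trans (le_of_eq ?_)
    simp [Real.zero_rpow hs0.ne']
  · exact le_ciInf fun y => hv x hx y y.2
  · rw [← sub_le_iff_le_add]
    refine le_ciInf fun z => ?_
    rw [sub_le_iff_le_add]
    refine (ciInf_le (hbdd x) z).trans ?_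
    have := mul_le_mul_of_nonneg_left (htri x y z) hL
    linarith

theorem continuous_of_holder {s : ℝ} (hs0 : 0 < s) {L : ℝ} {V : P → ℝ}
    (hV : ∀ x y, V x ≤ V y + L * dist x y ^ s) : Continuous V := by
  refine continuous_iff_continuousAt.2 fun x => ?_
  rw [ContinuousAt, tendsto_iff_dist_tendsto_zero]
  have h1 : Tendsto (fun y => L * dist y x ^ s) (𝓝 x) (𝓝 (L * dist x x ^ s)) :=
    ((continuous_id.dist continuous_const).rpow_const
      (fun _ => Or.inr hs0.le)).const_mul L |>.tendsto x
  rw [dist_self, Real.zero_rpow hs0.ne', mul_zero] at h1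
  refine squeeze_zero (fun _ => dist_nonneg) (fun y => ?_) h1
  rw [Real.dist_eq, abs_le]
  have h2 := hV x y
  have h3 := hV y x
  rw [dist_comm x y] at h2
  constructor <;> linarith

theorem abs_sub_coe_of_ne {a : EReal} (h1 : a ≠ ⊤) (h2 : a ≠ ⊥) (v : ℝ) :
    (a - (v : EReal)).abs = ENNReal.ofReal |a.toReal - v| := by
  conv_lhs => rw [← EReal.coe_toReal h1 h2, ← EReal.coe_sub, EReal.abs_def]

theorem lt_abs_sub_coe_iff {a : EReal} {v t : ℝ} (ht : 0 ≤ t) :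
    ENNReal.ofReal t < (a - (v : EReal)).abs ↔
      ((v + t : ℝ) : EReal) < a ∨ a < ((v - t : ℝ) : EReal) := by
  induction a with
  | bot =>
    have : (⊥ : EReal) < ((v - t : ℝ) : EReal) := EReal.bot_lt_coe _
    simp only [this, or_true, iff_true]
    simp
  | top =>
    have : ((v + t : ℝ) : EReal) < ⊤ := EReal.coe_lt_top _
    simp only [this, true_or, iff_true]
    simp
  | coe r =>
    rw [← EReal.coe_sub, EReal.abs_def, EReal.coe_lt_coe_iff, EReal.coe_lt_coe_iff,
      ENNReal.ofReal_lt_ofReal_iff_of_nonneg ht, lt_abs]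
    constructor <;> rintro (h | h)
    · left; linarith
    · right; linarith
    · left; linarith
    · right; linarith

variable [MeasurableSpace P] {μ : Measure P}

theorem aemeasurable_abs_sub_coe [BorelSpace P] {u : P → EReal} (hu : MemL0 μ u) {v : P → ℝ}
    (hv : Continuous v) : AEMeasurable (fun x => (u x - (v x : EReal)).abs) μ := by
  have h : AEMeasurable (fun x => ENNReal.ofReal |(u x).toReal - v x|) μ :=
    ENNReal.measurable_ofReal.comp_aemeasurable
      (continuous_abs.measurable.comp_aemeasurable
        (hu.1.ereal_toReal.sub hv.measurable.aemeasurable))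
  refine h.congr ?_
  filter_upwards [hu.2] with x hx
  exact (abs_sub_coe_of_ne hx.1 hx.2 _).symm

/-- Hölder truncation at height `l`: off the set `{g > l}` the function `u` agrees with a Hölder
function `v`, and `|u - v|` has the gradient `4 g χ_{g > l}`, which also controls its values on a
ball that meets `{g ≤ l}`. -/
theorem exists_truncation {s : ℝ} (hs0 : 0 < s) (hs1 : s ≤ 1) {u : P → EReal} {g : P → ℝ≥0∞}
    {N : Set P} (hN : μ N = 0) (hfin : ∀ x ∉ N, u x ≠ ⊤ ∧ u x ≠ ⊥)
    (hgrad : ∀ x ∉ N, ∀ y ∉ N,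
      ENNReal.ofReal |(u x).toReal - (u y).toReal| ≤ edist x y ^ s * (g x + g y))
    {l : ℕ} {B : Set P} {d : ℝ} (hB : ∀ x ∈ B, ∀ y ∈ B, dist x y ≤ d) {z : P} (hzB : z ∈ B)
    (hzN : z ∉ N) (hz : g z ≤ l) :
    ∃ v : P → ℝ, Continuous v ∧
      IsNonnegSGradientOn μ s univ (fun x => (u x - (v x : EReal)).abs)
        (fun x => (4 : ℝ≥0) * {x | (l : ℝ≥0∞) < g x}.indicator g x) ∧
      ∀ᵐ x ∂μ, x ∈ B → (u x - (v x : EReal)).abs ≤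
        ((d ^ s).toNNReal : ℝ≥0) * ((4 : ℝ≥0) * {x | (l : ℝ≥0∞) < g x}.indicator g x) := by
  set F : Set P := {x | x ∉ N ∧ g x ≤ l} with hF
  obtain ⟨v, hvF, hv⟩ := exists_holder_extension hs0 hs1 (L := 2 * l) (by positivity) (F := F)
    ⟨z, hzN, hz⟩ (v := fun x => (u x).toReal) (by
      rintro x ⟨hxN, hx⟩ y ⟨hyN, hy⟩
      have h1 := hgrad x hxN y hyN
      have h2 : edist x y ^ s * (g x + g y) ≤ ENNReal.ofReal (2 * l * dist x y ^ s) := by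
        calc edist x y ^ s * (g x + g y) ≤ edist x y ^ s * (l + l) := by gcongr
          _ = _ := by
            rw [edist_rpow_eq hs0, mul_comm (2 * (l : ℝ)), ENNReal.ofReal_mul (by positivity),
              ENNReal.ofReal_mul two_pos.le, ENNReal.ofReal_natCast, ENNReal.ofReal_ofNat, two_mul]
      have h3 := (ENNReal.ofReal_le_ofReal_iff (by positivity)).1 (h1.trans h2)
      linarith [le_abs_self ((u x).toReal - (u y).toReal)])
  set h : P → ℝ≥0∞ := fun x => (4 : ℝ≥0) * {x | (l : ℝ≥0∞) < g x}.indicator g x with hh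
  have hwN : ∀ x ∉ N, (u x - (v x : EReal)).abs = ENNReal.ofReal |(u x).toReal - v x| :=
    fun x hx => abs_sub_coe_of_ne (hfin x hx).1 (hfin x hx).2 _
  have hwF : ∀ x ∈ F, (u x - (v x : EReal)).abs = 0 := fun x hx => by
    rw [hwN x hx.1, hvF x hx]; simp
  have hgr : ∀ x ∉ N, ∀ y ∉ N, (u x - (v x : EReal)).abs ≤
      (u y - (v y : EReal)).abs + edist x y ^ s * (h x + h y) := by
    intro x hx y hy
    by_cases hxF : x ∈ F
    · rw [hwF x hxF]; exact zero_le
    have hxl : (l : ℝ≥0∞) < g x := by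
      by_contra hcon
      exact hxF ⟨hx, not_lt.1 hcon⟩
    have hhx : h x = 4 * g x := by
      simp [hh, hxl]
    have hgy : g y ≤ h y + l := by
      by_cases hyl : (l : ℝ≥0∞) < g y
      · have : h y = 4 * g y := by simp [hh, hyl]
        rw [this]
        refine le_trans ?_ le_self_add
        exact le_mul_of_one_le_left zero_le (by norm_num)
      · exact (not_lt.1 hyl).trans le_add_self
    have hvxy : |v x - v y| ≤ 2 * l * dist x y ^ s := by
      have h1 := hv x y
      have h2 := hv y x
      rw [dist_comm y x] at h2
      rw [abs_le]; constructor <;> linarith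
    have htri : |(u x).toReal - v x| ≤ |(u y).toReal - v y| + |(u x).toReal - (u y).toReal| +
        |v x - v y| := by
      have h1 := abs_add_three ((u y).toReal - v y) ((u x).toReal - (u y).toReal) (v y - v x)
      rw [abs_sub_comm (v y) (v x)] at h1
      refine le_trans (le_of_eq ?_) h1
      congr 1; ring
    rw [hwN x hx, hwN y hy]
    calc ENNReal.ofReal |(u x).toReal - v x|
        ≤ ENNReal.ofReal (|(u y).toReal - v y| + |(u x).toReal - (u y).toReal| +
          2 * l * dist x y ^ s) := ENNReal.ofReal_le_ofReal (by linarith)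
      _ = ENNReal.ofReal |(u y).toReal - v y| + ENNReal.ofReal |(u x).toReal - (u y).toReal| +
          edist x y ^ s * (l + l) := by
          rw [ENNReal.ofReal_add (by positivity) (by positivity),
            ENNReal.ofReal_add (by positivity) (by positivity), edist_rpow_eq hs0,
            mul_comm (2 * (l : ℝ)), ENNReal.ofReal_mul (by positivity),
            ENNReal.ofReal_mul two_pos.le, ENNReal.ofReal_natCast, ENNReal.ofReal_ofNat, two_mul]
      _ ≤ ENNReal.ofReal |(u y).toReal - v y| + edist x y ^ s * (g x + (h y + g x)) +
          edist x y ^ s * (g x + g x) := by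
          gcongr
          exact (hgrad x hx y hy).trans (by gcongr; exact hgy.trans (by gcongr))
      _ = _ := by rw [hhx]; ring
  refine ⟨v, continuous_of_holder hs0 hv, ⟨N, hN, fun x hx => ?_, fun x hx y hy =>
    hgr x hx.2 y hy.2⟩, ?_⟩
  · beta_reduce
    rw [hwN x hx.2]; exact ENNReal.ofReal_ne_top
  · filter_upwards [measure_eq_zero_iff_ae_notMem.1 hN] with x hx hxB
    have hhz : h z = 0 := by simp [hh, hz]
    refine (hgr x hx z hzN).trans ?_
    rw [hwF z ⟨hzN, hz⟩, zero_add, hhz, add_zero, edist_rpow_eq hs0]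
    gcongr
    refine ENNReal.ofReal_le_ofReal (Real.rpow_le_rpow dist_nonneg (hB x hxB z hzB) hs0.le)

end Truncation

/-! ### Lebesgue points -/

section LebesguePoints

variable {P : Type*} [MetricSpace P] [MeasurableSpace P] [BorelSpace P] {μ : Measure P}

/-- A point is a Lebesgue point of `u` if `u` can be approximated by continuous functions, both at
the point and in the mean over all small balls centred there. -/
theorem isLebesguePoint_of_approx (hμ : BallsPosFinite μ) {u : P → EReal} (hu : MemL0 μ u) {x : P}
    {r₁ : ℝ} (hr₁ : 0 < r₁)
    (happ : ∀ n : ℕ, ∃ v : P → ℝ, Continuous v ∧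
      (u x - (v x : EReal)).abs ≤ ((n : ℝ≥0∞) + 1)⁻¹ ∧
      ∀ r : ℝ, 0 < r → r ≤ r₁ →
        ⨍⁻ z in ball x r, (u z - (v z : EReal)).abs ∂μ ≤ ((n : ℝ≥0∞) + 1)⁻¹) :
    IsLebesguePoint μ u x := by
  have hmeas : AEMeasurable (fun y => (u y).toReal) μ := hu.1.ereal_toReal
  have hux : u x ≠ ⊤ ∧ u x ≠ ⊥ := by
    obtain ⟨v, -, h, -⟩ := happ 0
    constructor <;> intro h' <;> simp [h'] at h
  -- deviation of `u` from its value at `x`, through an approximation `v`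
  have hdev : ∀ n : ℕ, ∃ δ : ℝ, 0 < δ ∧ δ ≤ r₁ ∧ ∀ r : ℝ, 0 < r → r ≤ δ →
      ∫⁻ z in ball x r, ‖(u z).toReal - (u x).toReal‖ₑ ∂μ ≤
        3 * ((n : ℝ≥0∞) + 1)⁻¹ * μ (ball x r) := by
    intro n
    obtain ⟨v, hv, hvx, hvr⟩ := happ n
    set η : ℝ≥0∞ := ((n : ℝ≥0∞) + 1)⁻¹ with hη
    have hη0 : 0 < η := by
      rw [hη]; exact ENNReal.inv_pos.2 (by simp)
    obtain ⟨δ, hδ, hδv⟩ := EMetric.continuousAt_iff.1 hv.continuousAt η hη0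
    obtain ⟨δ', hδ'0, hδ'⟩ := ENNReal.lt_iff_exists_nnreal_btwn.1 hδ
    have hδ'0 : (0 : ℝ) < δ' := by exact_mod_cast hδ'0
    refine ⟨min δ' r₁, lt_min hδ'0 hr₁, min_le_right _ _, fun r hr hrδ => ?_⟩
    have hm := hμ x r hr
    have h1 : ∫⁻ z in ball x r, (u z - (v z : EReal)).abs ∂μ ≤ η * μ (ball x r) := by
      have := hvr r hr (hrδ.trans (min_le_right _ _))
      rw [setLAverage_eq] at this
      exact (ENNReal.div_le_iff hm.1.ne' hm.2.ne).1 this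
    calc ∫⁻ z in ball x r, ‖(u z).toReal - (u x).toReal‖ₑ ∂μ
        ≤ ∫⁻ z in ball x r, ((u z - (v z : EReal)).abs + 2 * η) ∂μ := by
          refine setLIntegral_mono_ae' measurableSet_ball ?_
          filter_upwards [hu.2] with z hz hzr
          rw [abs_sub_coe_of_ne hz.1 hz.2]
          rw [abs_sub_coe_of_ne hux.1 hux.2] at hvx
          have e : (u z).toReal - (u x).toReal =
              ((u z).toReal - v z) + ((v z - v x) + (v x - (u x).toReal)) := by ring
          have h2 : ‖v z - v x‖ₑ ≤ η := by
            rw [← edist_eq_enorm_sub]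
            refine (hδv ?_).le
            refine lt_trans ?_ hδ'
            rw [edist_dist, ← ENNReal.ofReal_coe_nnreal]
            refine (ENNReal.ofReal_lt_ofReal_iff hδ'0).2 ?_
            exact (mem_ball.1 hzr).trans_le (hrδ.trans (min_le_left _ _))
          have h3 : ‖v x - (u x).toReal‖ₑ ≤ η := by
            rw [← enorm_neg, neg_sub, Real.enorm_eq_ofReal_abs]; exact hvx
          rw [e, ← Real.enorm_eq_ofReal_abs, two_mul]
          exact (enorm_add_le _ _).trans
            (add_le_add le_rfl ((enorm_add_le _ _).trans (add_le_add h2 h3)))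
      _ = ∫⁻ z in ball x r, (u z - (v z : EReal)).abs ∂μ + 2 * η * μ (ball x r) := by
          rw [lintegral_add_right _ measurable_const, setLIntegral_const]
      _ ≤ η * μ (ball x r) + 2 * η * μ (ball x r) := by gcongr
      _ = _ := by ring
  have hfin : ∀ n : ℕ, 3 * ((n : ℝ≥0∞) + 1)⁻¹ ≠ ⊤ := fun n =>
    ENNReal.mul_ne_top (by simp) (ENNReal.inv_ne_top.2 (by simp))
  have hint : ∀ r : ℝ, 0 < r → ∫⁻ z in ball x r, ‖(u z).toReal - (u x).toReal‖ₑ ∂μ < ∞ →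
      IntegrableOn (fun z => (u z).toReal - (u x).toReal) (ball x r) μ := fun r hr h =>
    ⟨(hmeas.sub_const _).aestronglyMeasurable.restrict, h⟩
  have hconst : ∀ r : ℝ, 0 < r → IntegrableOn (fun _ => (u x).toReal) (ball x r) μ := fun r hr =>
    integrableOn_const (hμ x r hr).2.ne
  have hint' : ∀ r : ℝ, 0 < r → ∫⁻ z in ball x r, ‖(u z).toReal - (u x).toReal‖ₑ ∂μ < ∞ →
      IntegrableOn (fun z => (u z).toReal) (ball x r) μ := fun r hr h => by
    simpa [Pi.add_def] using (hint r hr h).add (hconst r hr)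
  refine ⟨hux, ?_, ?_⟩
  · obtain ⟨δ, hδ, -, h⟩ := hdev 0
    exact ⟨δ, hδ, hint' δ hδ ((h δ hδ le_rfl).trans_lt
      (ENNReal.mul_lt_top (hfin 0).lt_top (hμ x δ hδ).2))⟩
  · rw [EMetric.tendsto_nhds]
    intro ε hε
    obtain ⟨n, hn⟩ : ∃ n : ℕ, 3 * ((n : ℝ≥0∞) + 1)⁻¹ < ε := by
      have h1 : Tendsto (fun n : ℕ => 3 * ((n : ℝ≥0∞) + 1)⁻¹) atTop (𝓝 (3 * 0)) := by
        refine ENNReal.Tendsto.const_mul ?_ (Or.inr (by simp))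
        have := (tendsto_add_atTop_iff_nat 1).2 ENNReal.tendsto_inv_nat_nhds_zero
        simpa using this
      rw [mul_zero] at h1
      exact (h1.eventually (gt_mem_nhds hε)).exists
    obtain ⟨δ, hδ, -, h⟩ := hdev n
    filter_upwards [Ioc_mem_nhdsGT hδ] with r hr
    have hm := hμ x r hr.1
    have hle := h r hr.1 hr.2
    have hlt := hle.trans_lt (ENNReal.mul_lt_top (hfin n).lt_top hm.2)
    refine lt_of_le_of_lt ?_ hn
    have hmr : μ.real (ball x r) ≠ 0 := (ENNReal.toReal_pos hm.1.ne' hm.2.ne).ne'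
    have e : (⨍ z in ball x r, (u z).toReal ∂μ) - (u x).toReal =
        ⨍ z in ball x r, ((u z).toReal - (u x).toReal) ∂μ := by
      rw [setAverage_eq, setAverage_eq, integral_sub (hint' r hr.1 hlt) (hconst r hr.1),
        setIntegral_const, smul_sub, smul_smul, inv_mul_cancel₀ hmr, one_smul]
    rw [edist_eq_enorm_sub, e, setAverage_eq, enorm_smul]
    have hinv : ‖(μ.real (ball x r))⁻¹‖ₑ = (μ (ball x r))⁻¹ := by
      rw [Real.enorm_eq_ofReal (by positivity), measureReal_def, ENNReal.ofReal_inv_of_pos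
        (ENNReal.toReal_pos hm.1.ne' hm.2.ne), ENNReal.ofReal_toReal hm.2.ne]
    rw [hinv]
    calc (μ (ball x r))⁻¹ * ‖∫ z in ball x r, ((u z).toReal - (u x).toReal) ∂μ‖ₑ
        ≤ (μ (ball x r))⁻¹ * (3 * ((n : ℝ≥0∞) + 1)⁻¹ * μ (ball x r)) := by
          gcongr
          exact (enorm_integral_le_lintegral_enorm _).trans hle
      _ = 3 * ((n : ℝ≥0∞) + 1)⁻¹ := by
          rw [mul_comm, mul_assoc, ENNReal.mul_inv_cancel hm.1.ne' hm.2.ne, mul_one]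

/-- On a ball and at a fixed accuracy, the Hölder truncations of `u` approximate `u` outside a set
of capacity zero. -/
theorem exists_capacity_eq_zero_approx (hμ : BallsPosFinite μ) {Q : ℝ} (hQ : 0 < Q)
    (hμQ : LowerMassBound μ Q) (X : QuasiBanachFunctionSpace μ) (hX : X.AbsolutelyContinuous)
    {s : ℝ} (hs0 : 0 < s) (hs1 : s ≤ 1) (hM : MaximalLocallyBounded X (Q / (Q + s)))
    {u : P → EReal} (hu : MemHomHajlasz X s u) (huc : Quasicontinuous X s u) (x₀ : P) {R : ℝ}
    (hR : 0 < R) (n : ℕ) :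
    ∃ Z : Set P, capacity X s Z = 0 ∧ ∀ x ∈ ball x₀ R \ Z, ∃ v : P → ℝ, Continuous v ∧
      (u x - (v x : EReal)).abs ≤ ((n : ℝ≥0∞) + 1)⁻¹ ∧
      ∀ r : ℝ, 0 < r → r ≤ 1 / 32 →
        ⨍⁻ z in ball x r, (u z - (v z : EReal)).abs ∂μ ≤ ((n : ℝ≥0∞) + 1)⁻¹ := by
  obtain ⟨hu0, huN⟩ := hu
  simp only [homHajlaszNorm, iInf_lt_iff] at huN
  obtain ⟨g, ⟨hgm, N, hN, hfin, hgrad⟩, hg⟩ := huN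
  set B := ball x₀ (2 * R) with hB
  have hdiam : ∀ x ∈ B, ∀ y ∈ B, dist x y ≤ 4 * R := fun x hx y hy => by
    have h1 := mem_ball.1 hx
    have h2 := mem_ball.1 hy
    linarith [dist_triangle_right x y x₀]
  obtain ⟨z, hzB, hzN, hzg⟩ : ∃ z ∈ B, z ∉ N ∧ g z ≠ ⊤ := by
    have hnull : μ (N ∪ {x | ¬ g x ≠ ⊤}) = 0 :=
      measure_union_null hN (X.ae_ne_top_of_qnormNonneg_lt_top hg)
    obtain ⟨z, hzB, hz⟩ : (B \ (N ∪ {x | ¬ g x ≠ ⊤})).Nonempty := by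
      refine nonempty_of_measure_ne_zero (μ := μ) ?_
      rw [measure_sdiff_null hnull]
      exact (hμ x₀ (2 * R) (by positivity)).1.ne'
    exact ⟨z, hzB, fun h => hz (Or.inl h), fun h => hz (Or.inr (not_not.2 h))⟩
  obtain ⟨l₀, hl₀⟩ := ENNReal.exists_nat_gt hzg
  set A : ℝ≥0 := ((4 * R) ^ s).toNNReal with hA
  obtain ⟨K, hK⟩ := exists_capacity_union_le X s
  obtain ⟨C₁, hC₁⟩ := exists_capacity_superlevel_le X hs0 hs1 x₀ hR A
  obtain ⟨C₂, hC₂⟩ := exists_capacity_maximal_le X hμ hQ hμQ hs0 hs1 hM x₀ hR A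
  set τ : ℝ≥0 := n + 1 with hτ
  have hτ0 : 0 < τ := by positivity
  have htrunc := fun l : ℕ => exists_truncation (μ := μ) hs0 hs1 hN hfin hgrad (l := l + l₀) hdiam
    hzB hzN (hl₀.le.trans (by exact_mod_cast Nat.le_add_left l₀ l))
  choose v hvc hvg hvA using htrunc
  set w : ℕ → P → ℝ≥0∞ := fun l x => (u x - (v l x : EReal)).abs with hw
  set h : ℕ → P → ℝ≥0∞ := fun l x =>
    (4 : ℝ≥0) * {x | ((l + l₀ : ℕ) : ℝ≥0∞) < g x}.indicator g x with hh
  have hwm : ∀ l, AEMeasurable (w l) μ := fun l => aemeasurable_abs_sub_coe hu0 (hvc l)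
  have hhN : ∀ l, X.qnormNonneg (h l) ≤ 4 * X.qnormNonneg
      ({x | ((l + l₀ : ℕ) : ℝ≥0∞) < g x}.indicator g) := fun l => X.qnormNonneg_const_mul 4 _
  have hlim : Tendsto (fun l => X.qnormNonneg (h l)) atTop (𝓝 0) := by
    have h1 := (X.tendsto_qnormNonneg_indicator_lt hX hg).comp (tendsto_add_atTop_nat l₀)
    have h2 := ENNReal.Tendsto.const_mul (a := 4) h1 (Or.inr (by simp))
    rw [mul_zero] at h2
    exact tendsto_of_tendsto_of_tendsto_of_le_of_le tendsto_const_nhds h2 (fun _ => zero_le) hhN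
  have hhfin : ∀ l, X.qnormNonneg (h l) < ∞ := fun l => by
    refine (hhN l).trans_lt (ENNReal.mul_lt_top (by simp) (lt_of_le_of_lt ?_ hg))
    refine X.qnormNonneg_mono_ae (hgm.indicator₀ (nullMeasurableSet_lt aemeasurable_const hgm)) ?_
    exact Eventually.of_forall fun x => indicator_le_self _ _ x
  -- superlevel sets are open up to sets of small capacity
  have hqc : ∀ l, ∀ ε : ℝ≥0∞, 0 < ε → ∃ E O : Set P, capacity X s E < ε ∧ IsOpen O ∧
      {x | 1 < τ * w l x} ∩ Eᶜ = O ∩ Eᶜ := by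
    intro l ε hε
    obtain ⟨E, hE, hcont⟩ := huc ε hε
    set t : ℝ := (τ : ℝ)⁻¹ with ht
    have ht0 : 0 < t := by positivity
    have hset : {x | 1 < τ * w l x} =
        {x | ((v l x + t : ℝ) : EReal) < u x} ∪ {x | u x < ((v l x - t : ℝ) : EReal)} := by
      ext x
      have h1 : (1 < τ * w l x) ↔ ENNReal.ofReal t < w l x := by
        rw [ht, ENNReal.ofReal_inv_of_pos (by exact_mod_cast hτ0), ENNReal.ofReal_coe_nnreal,
          ENNReal.inv_lt_iff_inv_lt, mul_comm, ← ENNReal.div_lt_iff, one_div]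
        · rw [ENNReal.inv_lt_iff_inv_lt]
        · simp [hτ0.ne']
        · simp
      change (1 < τ * w l x) ↔ _
      rw [h1]
      exact lt_abs_sub_coe_iff ht0.le
    have hc1 : ContinuousOn (fun x => (((v l x + t : ℝ) : EReal), u x)) Eᶜ :=
      (continuous_coe_real_ereal.comp ((hvc l).add continuous_const)).continuousOn.prodMk hcont
    have hc2 : ContinuousOn (fun x => (u x, ((v l x - t : ℝ) : EReal))) Eᶜ :=
      hcont.prodMk (continuous_coe_real_ereal.comp ((hvc l).sub continuous_const)).continuousOn
    obtain ⟨O₁, hO₁, e1⟩ := continuousOn_iff'.1 hc1 {p | p.1 < p.2}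
      (isOpen_lt continuous_fst continuous_snd)
    obtain ⟨O₂, hO₂, e2⟩ := continuousOn_iff'.1 hc2 {p | p.1 < p.2}
      (isOpen_lt continuous_fst continuous_snd)
    refine ⟨E, O₁ ∪ O₂, hE, hO₁.union hO₂, ?_⟩
    rw [hset, union_inter_distrib_right, union_inter_distrib_right, ← e1, ← e2]
    rfl
  set S : ℕ → Set P := fun l => {x ∈ ball x₀ R | 1 < τ * w l x} ∪
    {x ∈ ball x₀ R | ∃ r : ℝ, 0 < r ∧ r ≤ 1 / 32 ∧ 1 < τ * ⨍⁻ z in ball x r, w l z ∂μ} with hS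
  have hSle : ∀ l, capacity X s (S l) ≤ (K * (C₁ * τ + C₂ * τ) : ℝ≥0) * X.qnormNonneg (h l) := by
    intro l
    refine (hK _ _).trans ?_
    calc _ ≤ K * (C₁ * τ * X.qnormNonneg (h l) + C₂ * τ * X.qnormNonneg (h l)) := by
          gcongr
          · exact hC₁ (w l) (h l) (hwm l) (hvg l) (hvA l) τ (hqc l)
          · exact hC₂ (w l) (h l) (hwm l) (hvg l) (hhfin l) (hvA l) τ
      _ = _ := by push_cast; ring
  have hle_inv : ∀ a : ℝ≥0∞, ¬ (1 < τ * a) → a ≤ ((n : ℝ≥0∞) + 1)⁻¹ := by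
    intro a ha
    have hτc : (τ : ℝ≥0∞) = n + 1 := by simp [hτ]
    rw [← hτc, ← one_div, ENNReal.le_div_iff_mul_le (by simp [hτ0.ne']) (by simp), mul_comm]
    exact not_lt.1 ha
  refine ⟨⋂ l, S l, ?_, ?_⟩
  · have h2 := ENNReal.Tendsto.const_mul (a := ((K * (C₁ * τ + C₂ * τ) : ℝ≥0) : ℝ≥0∞)) hlim
      (Or.inr ENNReal.coe_ne_top)
    rw [mul_zero] at h2
    exact le_antisymm (ge_of_tendsto' h2 fun l =>
      (capacity_mono X s (iInter_subset S l)).trans (hSle l)) zero_le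
  · rintro x ⟨hxB, hx⟩
    obtain ⟨l, hl⟩ : ∃ l, x ∉ S l := by
      by_contra! hcon
      exact hx (mem_iInter.2 hcon)
    refine ⟨v l, hvc l, hle_inv _ fun h1 => hl (Or.inl ⟨hxB, h1⟩), fun r hr hr1 => ?_⟩
    exact hle_inv _ fun h1 => hl (Or.inr ⟨hxB, r, hr, hr1, h1⟩)

end LebesguePoints

end HajlaszLebesgue

theorem theorem1p2 {P : Type*} [MetricSpace P] [MeasurableSpace P] [BorelSpace P]
    (μ : Measure P) (hμ : HajlaszLebesgue.BallsPosFinite μ)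
    (Q : ℝ) (hQ : 0 < Q) (hμQ : HajlaszLebesgue.LowerMassBound μ Q)
    (X : HajlaszLebesgue.QuasiBanachFunctionSpace μ) (hX : X.AbsolutelyContinuous)
    (s : ℝ) (hs0 : 0 < s) (hs1 : s ≤ 1)
    (hM : HajlaszLebesgue.MaximalLocallyBounded X (Q / (Q + s)))
    (u : P → EReal) (hu : HajlaszLebesgue.MemHomHajlasz X s u)
    (huc : HajlaszLebesgue.Quasicontinuous X s u) :
    HajlaszLebesgue.Quasieverywhere X s (HajlaszLebesgue.IsLebesguePoint μ u) := by
  open HajlaszLebesgue in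
  rcases isEmpty_or_nonempty P with hP | ⟨⟨x₀⟩⟩
  · exact ⟨∅, capacity_empty X s, fun x => (hP.false x).elim⟩
  choose Z hZ hZapp using fun m n : ℕ => exists_capacity_eq_zero_approx hμ hQ hμQ X hX hs0 hs1 hM
    hu huc x₀ (R := (m : ℝ) + 1) (by positivity) n
  refine ⟨⋃ m, ⋃ n, Z m n,
    capacity_iUnion_eq_zero X s fun m => capacity_iUnion_eq_zero X s fun n => hZ m n, ?_⟩
  intro x hx
  obtain ⟨m, hm⟩ := exists_nat_gt (dist x x₀)
  refine isLebesguePoint_of_approx hμ hu.1 (r₁ := 1 / 32) (by norm_num) fun n => ?_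
  refine hZapp m n x ⟨mem_ball.2 (by linarith), fun h => hx ?_⟩
  exact mem_iUnion.2 ⟨m, mem_iUnion.2 ⟨n, h⟩⟩
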